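/- Composition is written in diagrammatic order ($f;g$ is first $f$, then $g$), and monoidal coherence isomorphisms are suppressed. Let $\mathbb C$ be a ribbon category, that is, a braided monoidal category with unit object $\mathbb 1$, braid $\sigma$ and a twist $\theta$ (a natural isomorphism $\theta_X\colon X\to X$ with $\theta_{X\otimes Y}=\sigma_{X,Y};(\theta_Y\otimes\theta_X);\sigma_{Y,X}$), in which every object $X$ has a dual $X^*$ with unit $\eta_X\colon\mathbb 1\to X\otimes X^*$ and counit $\varepsilon_X\colon X^*\otimes X\to\mathbb 1$ (satisfying the snake equations), such that $(\theta_X)^*=\theta_{X^*}$. Its trace is $\mathit{Tr}^X_{Y,Z}(f)=(Y\otimes\eta_X);(f\otimes X^*);(Z\otimes(\sigma_{X,X^*};(X^*\otimes\theta_X);\varepsilon_X))$ for $f\colon Y\otimes X\to Z\otimes X$. Let $A$ be an object with an isomorphism $\varphi\colon A\otimes A^*\cong A$. Put $$\mathsf{app}=(\varphi^{-1}\otimes A);(A\otimes\varepsilon_A)\colon A\otimes A\to A,$$ $$\mathsf{lam}=(A\otimes\eta_A);(A\otimes A\otimes\theta_{A^*}^{-1});(A\otimes\sigma_{A^*,A}^{-1});(\varphi\otimes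 A)\colon A\to A\otimes A,$$ $\mathsf{lam}_0=\mathrm{id}_A$, $\mathsf{lam}_{m+1}=\mathsf{lam}_m;(\mathsf{lam}\otimes A^{\otimes m})$, $\mathsf{app}_0=\mathrm{id}_A$, $\mathsf{app}_{n+1}=(\mathsf{app}\otimes A^{\otimes n});\mathsf{app}_n$, and for $f\colon A^{\otimes m}\to A^{\otimes n}$ put $$F(f)=\mathit{Tr}^A_{\mathbb 1,A}\bigl(\mathsf{lam}_m;(\mathsf{lam}\otimes f);(A\otimes\mathsf{app}_n)\bigr)\in\mathcal A:=\mathbb C(\mathbb 1,A).$$ On $\mathcal A$ let $a\cdot b=(a\otimes b);\mathsf{app}$ (application, written by juxtaposition and associating to the left), $B=F(\mathsf{app})$, $I=F(\mathrm{id}_{\mathbb 1})$, $C^{+}=F(\sigma_{A,A})$, $C^{-}=F(\sigma_{A,A}^{-1})$, $\theta^{+}=F(\theta_A)$, $\theta^{-}=F(\theta_A^{-1})$, and write $a\circ b=B\,a\,b$, $a^0=I$, $a^{n+1}=a\circ a^n$, and $B^l\,a$ for $B$ applied $l$ times to $a$. Below, $\circ$ may be read as associating to the right; linked signs $\pm,\mp$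 are simultaneous, and each $\star$ is an arbitrary sign. (1) $\mathcal A$ is a balanced extensional $\mathbf{BC^\pm I}$-algebra: $B\,a\,b\,c=a\,(b\,c)$, $C^\star a\,b\,c=a\,c\,b$, $I\,a=a$, $C^+a\,b=C^-a\,b$, $B\,I=I$, $C^\star B\,I=B\,I$, $(C^\star B\,B)\circ(B\circ B)=(B\,B)\circ B$, $C^\pm\circ C^\mp=B\,(B\,I)$, $(C^\star B\,C^\pm)\circ(B\circ B)=(B\,C^\pm)\circ(B\circ B)$, $(B\,C^\pm)\circ(C^\pm\circ(B\,C^\pm))=C^\pm\circ((B\,C^\pm)\circ C^\pm)$, $(B\,B)\circ C^\pm=C^\pm\circ((B\,C^\pm)\circ B)$, $(B\,\theta^\pm)\circ B=(C^\star B\,\theta^\pm)\circ B$, $\theta^\pm\circ\theta^\mp=B\,I$, $C^\star\theta^\star a=C^\star I\,a$, $B\circ\theta^\pm=\theta^\pm\circ C^\pm\circ\theta^\pm\circ C^\pm\circ B$. Moreover $F(a)=a^\bullet:=C^\star I\,a$ for every $a\in\mathcal A$. (2) Say that $a\in\mathcal A$ is of arity $m\to n$, written $a\colon m\to n$, if $a^\bullet\circ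 B^{m+1}=(B\,a)\circ B^n$. These elements are the morphisms $m\to n$ of the internal PRO of $\mathcal A$, with composition $\circ$, identities $I$, and tensor product $a+b=a\circ(B^n\,b)$ for $a\colon m\to n$. Then $F$ is a strict monoidal functor to the internal PRO: $F(f)\colon m\to n$ for $f\colon A^{\otimes m}\to A^{\otimes n}$, $F(\mathrm{id})=I$, $F(f;g)=F(f)\circ F(g)$ and $F(f\otimes g)=F(f)+F(g)$. (3) Let $\mathbf{Tr}=F(\mathsf{lam})$, $\boldsymbol\alpha=F(\alpha)$, $\boldsymbol\beta=F(\beta)$, where $\alpha=\mathit{Tr}^A_{\mathbb 1,A\otimes A}(\mathsf{lam};(A\otimes\mathsf{lam}))$ and $\beta=\mathit{Tr}^A_{A\otimes A,\mathbb 1}((A\otimes\mathsf{app});\mathsf{app})$. Let $\boldsymbol\sigma_{m,n}\colon m+n\to n+m$ be given by $\boldsymbol\sigma_{0,1}=I$, $\boldsymbol\sigma_{m+1,1}=(B\,\boldsymbol\sigma_{m,1})\circ C^+$, $\boldsymbol\sigma_{m,0}=I$, $\boldsymbol\sigma_{m,n+1}=\boldsymbol\sigma_{m,1}\circ(B\,\boldsymbol\sigma_{m,n})$,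 and let $\boldsymbol\sigma_{m,n}^{-1}$ be the reversed composite with $C^-$ for $C^+$. In the internal PRO, the trace of $b\colon m+1\to n+1$ is $\mathit{Tr}^1_{m,n}(b)=(B^m\boldsymbol\alpha)\circ b\circ(B^n(C^+\circ(B\,\theta^+)\circ\boldsymbol\beta))$, and the left trace of $a\colon 1+m\to 1+n$ is $\mathit{Tr_L}^1_{m,n}(a)=\mathit{Tr}^1_{m,n}(\boldsymbol\sigma_{1,m}^{-1}\circ a\circ\boldsymbol\sigma_{1,n})$. Then for all $m,n\ge 0$ and every $a\in\mathcal A$ of arity $1+m\to 1+n$, the element $\mathbf{Tr}\cdot a$ is of arity $m\to n$ and $$\mathbf{Tr}\cdot a=\mathit{Tr_L}^1_{m,n}(a)=\boldsymbol\alpha\circ(B\,a)\circ\boldsymbol\beta .$$ (4) $\mathcal A$ is a ribbon combinatory algebra, in both equivalent forms. It is traced by $\mathbf{Tr}$: $(C^\star B\,\mathbf{Tr})\circ B=(B\,\mathbf{Tr})\circ B^2$, $(B\,\mathbf{Tr})\circ(C^\star B\,B)\circ B=B\circ\mathbf{Tr}$, $\mathbf{Tr}\,C^\pm=\theta^\pm$,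 $\mathbf{Tr}^2\circ(C^\star B\,C^-)\circ(B\,C^+)=\mathbf{Tr}^2$. And it has the duality $\boldsymbol\alpha,\boldsymbol\beta$: $\boldsymbol\alpha^\bullet\circ B=(B\,\boldsymbol\alpha)\circ B^2$, $\boldsymbol\beta^\bullet\circ B^3=B\,\boldsymbol\beta$, $\boldsymbol\alpha\circ(B\,\boldsymbol\beta)=B\,I=(B\,\boldsymbol\alpha)\circ\boldsymbol\beta$, $\boldsymbol\alpha\circ\theta^\pm=\boldsymbol\alpha\circ(B\,\theta^\pm)$. -/

import Mathlib

open CategoryTheory MonoidalCategory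

universe v u w

namespace RibbonCA

/-! ## Combinatory algebras -/

/-- The data of a balanced `BC±I`-algebra on a carrier `𝒜`: an application, and the elements
`B`, `I`, `C⁺ = C true`, `C⁻ = C false`, `θ⁺ = θ true`, `θ⁻ = θ false`. -/
structure BalancedData (𝒜 : Type w) where
  /-- application `a · b` -/
  ap : 𝒜 → 𝒜 → 𝒜
  /-- the combinator `B` -/
  B : 𝒜
  /-- the combinator `I` -/
  I : 𝒜
  /-- the combinators `C⁺` (`true`) and `C⁻` (`false`) -/
  C : Bool → 𝒜
  /-- the combinators `θ⁺` (`true`) and `θ⁻` (`false`) -/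
  θ : Bool → 𝒜

namespace BalancedData

/-- `a ∘ b = B a b`. -/
def comp {𝒜 : Type w} (D : BalancedData 𝒜) (a b : 𝒜) : 𝒜 := D.ap (D.ap D.B a) b

/-- `a⁰ = I`, `aⁿ⁺¹ = a ∘ aⁿ`. -/
def pow {𝒜 : Type w} (D : BalancedData 𝒜) (a : 𝒜) : ℕ → 𝒜
  | 0 => D.I
  | n + 1 => D.comp a (D.pow a n)

/-- `Bˡ a`, that is, `B` applied `l` times to `a`; this is `l + a` in the internal PRO. -/
def shift {𝒜 : Type w} (D : BalancedData 𝒜) : ℕ → 𝒜 → 𝒜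
  | 0, a => a
  | l + 1, a => D.ap D.B (D.shift l a)

/-- `a^• = C⁺ I a`. -/
def bullet {𝒜 : Type w} (D : BalancedData 𝒜) (a : 𝒜) : 𝒜 := D.ap (D.ap (D.C true) D.I) a

section

variable {𝒜 : Type w} (D : BalancedData 𝒜)

local infixl:75 " ⬝ " => BalancedData.ap D
local infixr:70 " ⊚ " => BalancedData.comp D

/-- `a` is of arity `m → n`: `a^• ∘ Bᵐ⁺¹ = (B a) ∘ Bⁿ`. The elements of arity `m → n` are the
morphisms `m → n` of the internal PRO. -/
def Arity (m n : ℕ) (a : 𝒜) : Prop :=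
  D.bullet a ⊚ D.pow D.B (m + 1) = (D.B ⬝ a) ⊚ D.pow D.B n

/-- The tensor product `a + b` of `a : m → n` and `b` in the internal PRO, which is
`(a + m') ; (n + b)`, where `a + m' = a` and `n + b = Bⁿ b`. -/
def tensor (n : ℕ) (a b : 𝒜) : 𝒜 := a ⊚ D.shift n b

/-- The axioms of an extensional `BC±I`-algebra. Linked double signs are one sign `s` with
opposite sign `!s`; arbitrary choices of a sign are independent signs `t`. -/
structure IsExtensional : Prop where
  ax_B : ∀ a b c, D.B ⬝ a ⬝ b ⬝ c = a ⬝ (b ⬝ c)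
  ax_C : ∀ t a b c, D.C t ⬝ a ⬝ b ⬝ c = a ⬝ c ⬝ b
  ax_I : ∀ a, D.I ⬝ a = a
  ax_C2 : ∀ a b, D.C true ⬝ a ⬝ b = D.C false ⬝ a ⬝ b
  ax_lambda : D.B ⬝ D.I = D.I
  ax_rho : ∀ t, D.C t ⬝ D.B ⬝ D.I = D.B ⬝ D.I
  ax_alpha : ∀ t, (D.C t ⬝ D.B ⬝ D.B) ⊚ (D.B ⊚ D.B) = (D.B ⬝ D.B) ⊚ D.B
  ax_cox1 : ∀ s, D.C s ⊚ D.C (!s) = D.B ⬝ (D.B ⬝ D.I)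
  ax_cox2 : ∀ t s, (D.C t ⬝ D.B ⬝ D.C s) ⊚ (D.B ⊚ D.B) = (D.B ⬝ D.C s) ⊚ (D.B ⊚ D.B)
  ax_cox3 : ∀ s, (D.B ⬝ D.C s) ⊚ (D.C s ⊚ (D.B ⬝ D.C s)) =
    D.C s ⊚ ((D.B ⬝ D.C s) ⊚ D.C s)
  ax_bc : ∀ s, (D.B ⬝ D.B) ⊚ D.C s = D.C s ⊚ ((D.B ⬝ D.C s) ⊚ D.B)

/-- The axioms of a balanced extensional `BC±I`-algebra. -/
structure IsBalanced : Prop extends IsExtensional D where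
  ax_theta1 : ∀ t s, (D.B ⬝ D.θ s) ⊚ D.B = (D.C t ⬝ D.B ⬝ D.θ s) ⊚ D.B
  ax_theta2 : ∀ s, D.θ s ⊚ D.θ (!s) = D.B ⬝ D.I
  ax_theta3 : ∀ t s t' a, D.C t ⬝ D.θ s ⬝ a = D.C t' ⬝ D.I ⬝ a
  ax_theta4 : ∀ s, D.B ⊚ D.θ s = D.θ s ⊚ D.C s ⊚ D.θ s ⊚ D.C s ⊚ D.B

/-- The axioms of a traced balanced extensional `BC±I`-algebra with trace combinator `Tr`, also
called a ribbon combinatory algebra. -/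
structure IsTraced (Tr : 𝒜) : Prop extends IsBalanced D where
  left_tightening : ∀ t, (D.C t ⬝ D.B ⬝ Tr) ⊚ D.B = (D.B ⬝ Tr) ⊚ D.pow D.B 2
  right_tightening : ∀ t, (D.B ⬝ Tr) ⊚ (D.C t ⬝ D.B ⬝ D.B) ⊚ D.B = D.B ⊚ Tr
  yanking : ∀ s, Tr ⬝ D.C s = D.θ s
  exchange : ∀ t, D.pow Tr 2 ⊚ (D.C t ⬝ D.B ⬝ D.C false) ⊚ (D.B ⬝ D.C true) = D.pow Tr 2

/-- The axioms of a ribbon extensional `BC±I`-algebra with duality `α`, `β`; the equivalent form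
of ribbon combinatory algebras by duality. -/
structure IsRibbon (α β : 𝒜) : Prop extends IsBalanced D where
  arity_alpha : D.bullet α ⊚ D.B = (D.B ⬝ α) ⊚ D.pow D.B 2
  arity_beta : D.bullet β ⊚ D.pow D.B 3 = D.B ⬝ β
  duality1 : α ⊚ (D.B ⬝ β) = D.B ⬝ D.I
  duality2 : (D.B ⬝ α) ⊚ β = D.B ⬝ D.I
  duality_theta : ∀ s, α ⊚ D.θ s = α ⊚ (D.B ⬝ D.θ s)

/-- The braid `σ_{m,1} : m + 1 → 1 + m` of the internal PRO. -/
def sigmaOne : ℕ → 𝒜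
  | 0 => D.I
  | m + 1 => (D.B ⬝ sigmaOne m) ⊚ D.C true

/-- The braid `σ_{m,n} : m + n → n + m` of the internal PRO. -/
def sigma (m : ℕ) : ℕ → 𝒜
  | 0 => D.I
  | n + 1 => D.sigmaOne m ⊚ (D.B ⬝ sigma m n)

/-- The inverse of `σ_{m,1}`: the reversed composite, with `C⁻` for `C⁺`. -/
def sigmaOneInv : ℕ → 𝒜
  | 0 => D.I
  | m + 1 => D.C false ⊚ (D.B ⬝ sigmaOneInv m)

/-- The inverse of `σ_{m,n}`: the reversed composite, with `C⁻` for `C⁺`. -/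
def sigmaInv (m : ℕ) : ℕ → 𝒜
  | 0 => D.I
  | n + 1 => (D.B ⬝ sigmaInv m n) ⊚ D.sigmaOneInv m

/-- The (right) trace `Tr¹_{m,n}(a) : m → n` of `a : m + 1 → n + 1` in the internal PRO, for the
self-duality of `1` with unit `α` and counit `β`:
`(m + α) ; (a + 1) ; (n + (σ_{1,1} ; (1 + θ) ; β))`. -/
def rightTrace (α β : 𝒜) (m n : ℕ) (a : 𝒜) : 𝒜 :=
  D.shift m α ⊚ a ⊚ D.shift n (D.C true ⊚ (D.B ⬝ D.θ true) ⊚ β)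

/-- The left trace of `a : 1 + m → 1 + n` in the internal PRO: the (right) trace of
`σ_{1,m}⁻¹ ; a ; σ_{1,n}`. -/
def leftTrace (α β : 𝒜) (m n : ℕ) (a : 𝒜) : 𝒜 :=
  D.rightTrace α β m n (D.sigmaInv 1 m ⊚ a ⊚ D.sigma 1 n)

end

end BalancedData

/-! ## Ribbon categories -/

/-- A balanced monoidal category: a braided monoidal category with a twist. -/
class BalancedCategory (C : Type u) [Category.{v} C] [MonoidalCategory C]
    [BraidedCategory C] where
  /-- the twist `θ_X` -/
  twist : ∀ X : C, X ≅ X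
  twist_naturality : ∀ {X Y : C} (f : X ⟶ Y), (twist X).hom ≫ f = f ≫ (twist Y).hom
  twist_tensor : ∀ X Y : C, (twist (X ⊗ Y)).hom =
    (β_ X Y).hom ≫ ((twist Y).hom ⊗ₘ (twist X).hom) ≫ (β_ Y X).hom

open BalancedCategory

/-- A ribbon category: a balanced monoidal category in which every object `X` has a dual
`X* = Xᘁ`, with unit `I ⟶ X ⊗ X*` and counit `X* ⊗ X ⟶ I`, such that `(θ_X)* = θ_{X*}`. -/
class RibbonCategory (C : Type u) [Category.{v} C] [MonoidalCategory C] [BraidedCategory C]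
    [BalancedCategory C] [RightRigidCategory C] : Prop where
  twist_dual : ∀ X : C, rightAdjointMate (twist X).hom = (twist (Xᘁ : C)).hom

section

variable {C : Type u} [Category.{v} C] [MonoidalCategory C] [BraidedCategory C]
  [BalancedCategory C] [RightRigidCategory C]

/-- The trace `Tr^X_{Y,Z}(f) : Y ⟶ Z` of `f : Y ⊗ X ⟶ Z ⊗ X`. -/
def catTrace {X Y Z : C} (f : Y ⊗ X ⟶ Z ⊗ X) : Y ⟶ Z :=
  (ρ_ Y).inv ≫ Y ◁ η_ X (Xᘁ : C) ≫ (α_ Y X (Xᘁ : C)).inv ≫ f ▷ (Xᘁ : C) ≫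
    (α_ Z X (Xᘁ : C)).hom ≫
    Z ◁ ((β_ X (Xᘁ : C)).hom ≫ (Xᘁ : C) ◁ (twist X).hom ≫ ε_ X (Xᘁ : C)) ≫ (ρ_ Z).hom

/-- Tensor powers: `A^{⊗0} = I`, `A^{⊗(n+1)} = A ⊗ A^{⊗n}`. -/
def tpow (A : C) : ℕ → C
  | 0 => 𝟙_ C
  | n + 1 => A ⊗ tpow A n

/-- The canonical isomorphism `A^{⊗1} ≅ A`. -/
def tpowOne (A : C) : tpow A 1 ≅ A := ρ_ A

/-- The canonical isomorphism `A^{⊗2} ≅ A ⊗ A`. -/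
def tpowTwo (A : C) : tpow A 2 ≅ A ⊗ A := whiskerLeftIso A (ρ_ A)

/-- The canonical isomorphism `A^{⊗m} ⊗ A^{⊗l} ≅ A^{⊗(m+l)}`; the exponent is written `l + m`
to suit the recursion. -/
def tpowAdd (A : C) (l : ℕ) : (m : ℕ) → (tpow A m ⊗ tpow A l ≅ tpow A (l + m))
  | 0 => λ_ (tpow A l)
  | m + 1 => α_ A (tpow A m) (tpow A l) ≪≫ whiskerLeftIso A (tpowAdd A l m)

variable {A : C} (φ : A ⊗ (Aᘁ : C) ≅ A)

/-- `app : A ⊗ A ⟶ A`. -/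
def app : A ⊗ A ⟶ A :=
  φ.inv ▷ A ≫ (α_ A (Aᘁ : C) A).hom ≫ A ◁ ε_ A (Aᘁ : C) ≫ (ρ_ A).hom

/-- `lam : A ⟶ A ⊗ A`. -/
def lam : A ⟶ A ⊗ A :=
  (ρ_ A).inv ≫
    A ◁ (η_ A (Aᘁ : C) ≫ A ◁ (twist (Aᘁ : C)).inv ≫ (β_ (Aᘁ : C) A).inv) ≫
    (α_ A (Aᘁ : C) A).inv ≫ φ.hom ▷ A

/-- `lam_m : A ⟶ A^{⊗(m+1)}`, with `lam_{m+1} = lam_m ; (lam ⊗ A^{⊗m})`. -/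
def lamN : (m : ℕ) → (A ⟶ A ⊗ tpow A m)
  | 0 => (ρ_ A).inv
  | m + 1 => lamN m ≫ lam φ ▷ tpow A m ≫ (α_ A A (tpow A m)).hom

/-- `app_n : A^{⊗(n+1)} ⟶ A`, with `app_{n+1} = (app ⊗ A^{⊗n}) ; app_n`. -/
def appN : (n : ℕ) → (A ⊗ tpow A n ⟶ A)
  | 0 => (ρ_ A).hom
  | n + 1 => (α_ A A (tpow A n)).inv ≫ app φ ▷ tpow A n ≫ appN n

/-- The action on morphisms of the functor `F` from the full subcategory of tensor powers of `A`
to the internal PRO of `C(I, A)`. -/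
def F {m n : ℕ} (f : tpow A m ⟶ tpow A n) : 𝟙_ C ⟶ A :=
  catTrace (X := A) (Y := 𝟙_ C) (Z := A)
    ((λ_ A).hom ≫ lamN φ m ≫ (lam φ ⊗ₘ f) ≫ (α_ A A (tpow A n)).hom ≫ A ◁ appN φ n)

/-- The unit `α = Tr^A(lam ; (A ⊗ lam)) : I ⟶ A ⊗ A` of the self-duality of `A`. -/
def dualUnit : 𝟙_ C ⟶ A ⊗ A :=
  catTrace (X := A) (Y := 𝟙_ C) (Z := A ⊗ A)
    ((λ_ A).hom ≫ lam φ ≫ A ◁ lam φ ≫ (α_ A A A).inv)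

/-- The counit `β = Tr^A((A ⊗ app) ; app) : A ⊗ A ⟶ I` of the self-duality of `A`. -/
def dualCounit : A ⊗ A ⟶ 𝟙_ C :=
  catTrace (X := A) (Y := A ⊗ A) (Z := 𝟙_ C)
    ((α_ A A A).hom ≫ A ◁ app φ ≫ app φ ≫ (λ_ A).inv)

/-- The set `C(I, A)` with `a · b = (a ⊗ b) ; app`, `B = F(app)`, `I = F(id_I)`,
`C⁺ = F(σ)`, `C⁻ = F(σ⁻¹)`, `θ⁺ = F(θ)`, `θ⁻ = F(θ⁻¹)`. -/
def reflexiveAlgebra : BalancedData (𝟙_ C ⟶ A) where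
  ap a b := (λ_ (𝟙_ C)).inv ≫ (a ⊗ₘ b) ≫ app φ
  B := F φ (m := 2) (n := 1) ((tpowTwo A).hom ≫ app φ ≫ (tpowOne A).inv)
  I := F φ (m := 0) (n := 0) (𝟙 (𝟙_ C))
  C s := F φ (m := 2) (n := 2)
    ((tpowTwo A).hom ≫ (if s then (β_ A A).hom else (β_ A A).inv) ≫ (tpowTwo A).inv)
  θ s := F φ (m := 1) (n := 1)
    ((tpowOne A).hom ≫ (if s then (twist A).hom else (twist A).inv) ≫ (tpowOne A).inv)

/-- `F(a) : 0 → 1` for an element `a` of `C(I, A)`. -/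
def FElem (a : 𝟙_ C ⟶ A) : 𝟙_ C ⟶ A := F φ (m := 0) (n := 1) (a ≫ (tpowOne A).inv)

/-- The trace combinator `Tr = F(lam) : 1 → 2`. -/
def traceComb : 𝟙_ C ⟶ A :=
  F φ (m := 1) (n := 2) ((tpowOne A).hom ≫ lam φ ≫ (tpowTwo A).inv)

/-- The combinator `F(α) : 0 → 2`. -/
def alphaComb : 𝟙_ C ⟶ A := F φ (m := 0) (n := 2) (dualUnit φ ≫ (tpowTwo A).inv)

/-- The combinator `F(β) : 2 → 0`. -/
def betaComb : 𝟙_ C ⟶ A := F φ (m := 2) (n := 0) ((tpowTwo A).hom ≫ dualCounit φ)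

end

end RibbonCA

open RibbonCA

/-! The isomorphism φ makes A its own object of endomorphisms: `app` is evaluation, and every map W
⊗ A ⟶ A is (f ⊗ A) ; `app` for a unique f : W ⟶ A. So an element is determined by its action x ↦ a ·
x, and even by that action after further arguments are supplied. Say that a represents f : X ⟶ Y if
a k x = k (f x) (`Rep`). Representatives are unique, a ∘ b represents the composite, B a represents
A ◁ f, and a itself represents f ▷ Z. The central fact `act_F` is that F(f) represents f. Hence F is
strict monoidal, and the axioms become equations in the ribbon category: hexagons, Yang–Baxter,
naturality of the twist, snake equations.

`act_F` rests on cyclicity of the trace and its independence of the chosen dual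
(`pairTrace_cyclic`). Transported along φ to A ⊗ A*, the trace of k becomes the trace of lam ; (k ⊗
A) ; app. This removes lam_m and app_m from F(f), and snake equations finish.

Likewise α and β are the nested self-duality of A ⊗ A* carried along φ, and this duality is
unchanged by twisting. It follows that lam k = (β k α') ⊗ α'', where α = α' ⊗ α'', whence Tr · a = α
∘ (B a) ∘ β for every a.

An element of arity m → n is not assumed to be some F(f), so the left trace is treated through the
arity equation itself, which reads Bᵐ k (a x) = a (Bⁿ k x). It yields the interchange law and
naturality of the braid σ_{1,n}; the braids in the left trace then slide through α and β and cancel.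
-/

namespace RibbonCA

open BalancedCategory

/-! ### Dualities in a monoidal category and their mates -/

section Pairings

variable {C : Type u} [Category.{v} C] [MonoidalCategory C]

/-- The snake equations for a unit `η` and a counit `ε` of a duality between `X` and `Y`. -/
structure Zigzag {X Y : C} (η : 𝟙_ C ⟶ X ⊗ Y) (ε : Y ⊗ X ⟶ 𝟙_ C) : Prop where
  coev_ev : Y ◁ η ≫ (α_ Y X Y).inv ≫ ε ▷ Y = (ρ_ Y).hom ≫ (λ_ Y).inv
  ev_coev : η ▷ X ≫ (α_ X Y X).hom ≫ X ◁ ε = (λ_ X).hom ≫ (ρ_ X).inv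

theorem zigzag_exactPairing (X Y : C) [ExactPairing X Y] : Zigzag (η_ X Y) (ε_ X Y) :=
  ⟨ExactPairing.coevaluation_evaluation X Y, ExactPairing.evaluation_coevaluation X Y⟩

namespace Zigzag

variable {X Y X' Y' : C} {η : 𝟙_ C ⟶ X ⊗ Y} {ε : Y ⊗ X ⟶ 𝟙_ C}
  {η' : 𝟙_ C ⟶ X' ⊗ Y'} {ε' : Y' ⊗ X' ⟶ 𝟙_ C}

/-- The exact pairing given by the snake equations. -/
abbrev exactPairing (h : Zigzag η ε) : ExactPairing X Y where
  coevaluation' := η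
  evaluation' := ε
  coevaluation_evaluation' := h.coev_ev
  evaluation_coevaluation' := h.ev_coev

theorem coev_ev' (h : Zigzag η ε) : Y ◁ η ⊗≫ ε ▷ Y = ⊗𝟙.hom := by
  convert! h.coev_ev <;> simp [monoidalComp]

theorem ev_coev' (h : Zigzag η ε) : η ▷ X ⊗≫ X ◁ ε = ⊗𝟙.hom := by
  convert! h.ev_coev <;> simp [monoidalComp]

/-- Bending the strand `X` back with `η` recovers `f` from its pairing. -/
theorem cancel_ev (h : Zigzag η ε) {W : C} {f g : W ⟶ Y} (e : f ▷ X ≫ ε = g ▷ X ≫ ε) :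
    f = g := by
  have key : ∀ f : W ⟶ Y, f = (ρ_ W).inv ≫ W ◁ η ≫ (α_ W X Y).inv ≫ (f ▷ X ≫ ε) ▷ Y ≫
      (λ_ Y).hom := by
    intro f
    symm
    calc _ = 𝟙 _ ⊗≫ (W ◁ η ≫ f ▷ (X ⊗ Y)) ⊗≫ ε ▷ Y ⊗≫ 𝟙 _ := by monoidal
      _ = 𝟙 _ ⊗≫ f ⊗≫ (Y ◁ η ⊗≫ ε ▷ Y) ⊗≫ 𝟙 _ := by rw [whisker_exchange]; monoidal
      _ = _ := by rw [h.coev_ev']; monoidal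
  rw [key f, key g, e]

/-- The mate is `f` bent around by `η` and `ε'`. The two equations let a morphism slide over a
counit and over a unit, also between different dualities. -/
theorem exists_mate (h : Zigzag η ε) (h' : Zigzag η' ε') (f : X ⟶ X') :
    ∃ g : Y' ⟶ Y, g ▷ X ≫ ε = Y' ◁ f ≫ ε' ∧ η ≫ f ▷ Y = η' ≫ X' ◁ g := by
  refine ⟨(ρ_ Y').inv ≫ Y' ◁ η ≫ Y' ◁ f ▷ Y ≫ (α_ Y' X' Y).inv ≫ ε' ▷ Y ≫ (λ_ Y).hom, ?_, ?_⟩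
  · calc _ = 𝟙 _ ⊗≫ Y' ◁ η ▷ X ⊗≫ Y' ◁ f ▷ (Y ⊗ X) ⊗≫ (ε' ▷ (Y ⊗ X) ≫ 𝟙_ C ◁ ε) ⊗≫ 𝟙 _ := by
          monoidal
      _ = 𝟙 _ ⊗≫ Y' ◁ η ▷ X ⊗≫ Y' ◁ (f ▷ (Y ⊗ X) ≫ X' ◁ ε) ⊗≫ ε' ⊗≫ 𝟙 _ := by
          rw [← whisker_exchange]; monoidal
      _ = 𝟙 _ ⊗≫ Y' ◁ (η ▷ X ⊗≫ X ◁ ε) ⊗≫ Y' ◁ f ⊗≫ ε' ⊗≫ 𝟙 _ := by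
          rw [← whisker_exchange]; monoidal
      _ = _ := by rw [h.ev_coev']; monoidal
  · symm
    calc _ = 𝟙 _ ⊗≫ (η' ▷ 𝟙_ C ≫ (X' ⊗ Y') ◁ (η ≫ f ▷ Y)) ⊗≫ X' ◁ ε' ▷ Y ⊗≫ 𝟙 _ := by monoidal
      _ = 𝟙 _ ⊗≫ (η ≫ f ▷ Y) ⊗≫ (η' ▷ X' ⊗≫ X' ◁ ε') ▷ Y ⊗≫ 𝟙 _ := by
          rw [← whisker_exchange]; monoidal
      _ = _ := by rw [h'.ev_coev']; monoidal

theorem coev_of_ev (h : Zigzag η ε) {f : Y ⟶ Y} {g : X ⟶ X} (e : f ▷ X ≫ ε = Y ◁ g ≫ ε) :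
    η ≫ g ▷ Y = η ≫ X ◁ f := by
  obtain ⟨k, hk, hk'⟩ := h.exists_mate h g
  rw [hk', h.cancel_ev (hk.trans e.symm)]

/-- The mate of the identity between the two dualities is the identity, because they share the
counit. -/
theorem unique_coev {η₂ : 𝟙_ C ⟶ X ⊗ Y} (h : Zigzag η ε) (h₂ : Zigzag η₂ ε) : η = η₂ := by
  obtain ⟨k, hk, hk'⟩ := h.exists_mate h₂ (𝟙 X)
  have : k = 𝟙 Y := h.cancel_ev (by simpa using hk)
  simpa [this] using hk'

/-- Transport of a duality along isomorphisms. -/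
theorem congr (h : Zigzag η ε) (e : X ≅ X') (f : Y ≅ Y') :
    Zigzag (η ≫ (e.hom ⊗ₘ f.hom)) ((f.inv ⊗ₘ e.inv) ≫ ε) := by
  let := h.exactPairing
  let := exactPairingCongrLeft (Y := Y) e.symm
  let := exactPairingCongrRight (X := X') f.symm
  have := zigzag_exactPairing X' Y'
  convert! this using 1
  · change _ = (η ≫ e.hom ▷ _) ≫ _ ◁ f.hom
    rw [MonoidalCategory.tensorHom_def, Category.assoc]
  · change _ = f.inv ▷ _ ≫ _ ◁ e.inv ≫ ε
    rw [MonoidalCategory.tensorHom_def, Category.assoc]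

end Zigzag

/-- The nested unit of a tensor product. -/
def nestCoev {X Y X' Y' : C} (η : 𝟙_ C ⟶ X ⊗ Y) (η' : 𝟙_ C ⟶ X' ⊗ Y') :
    𝟙_ C ⟶ (X ⊗ X') ⊗ (Y' ⊗ Y) :=
  η ⊗≫ (X ◁ η') ▷ Y ⊗≫ 𝟙 _

/-- The nested counit of a tensor product. -/
def nestEv {X Y X' Y' : C} (ε : Y ⊗ X ⟶ 𝟙_ C) (ε' : Y' ⊗ X' ⟶ 𝟙_ C) :
    (Y' ⊗ Y) ⊗ (X ⊗ X') ⟶ 𝟙_ C :=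
  𝟙 _ ⊗≫ Y' ◁ (ε ▷ X') ⊗≫ ε'

theorem Zigzag.nest {X Y X' Y' : C} {η : 𝟙_ C ⟶ X ⊗ Y} {ε : Y ⊗ X ⟶ 𝟙_ C}
    {η' : 𝟙_ C ⟶ X' ⊗ Y'} {ε' : Y' ⊗ X' ⟶ 𝟙_ C} (h : Zigzag η ε) (h' : Zigzag η' ε') :
    Zigzag (nestCoev η η') (nestEv ε ε') := by
  let := h.exactPairing
  let := h'.exactPairing
  exact zigzag_exactPairing (X ⊗ X') (Y' ⊗ Y)

end Pairings

/-! ### Crossings, twists and cyclicity of the trace -/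

section Braided

variable {C : Type u} [Category.{v} C] [MonoidalCategory C] [BraidedCategory C]

/-- A strand passes through a counit on one side or on the other. -/
theorem whiskerLeft_braiding_ev {X Y : C} (Z : C) (ε : Y ⊗ X ⟶ 𝟙_ C) :
    Y ◁ (β_ Z X).hom ⊗≫ ε ▷ Z = 𝟙 _ ⊗≫ (β_ Z Y).inv ▷ X ⊗≫ Z ◁ ε ⊗≫ 𝟙 _ := by
  -- Naturality of the braiding in `ε`: by the hexagon the strand `Z` crosses `Y` and then `X`,
  -- while its crossing with the unit object is trivial. The crossing with `Y` is moved to the other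
  -- side.
  have h := BraidedCategory.braiding_naturality_right Z ε
  rw [BraidedCategory.braiding_tensor_right_hom, braiding_tensorUnit_right] at h
  calc _ = 𝟙 _ ⊗≫ (β_ Z Y).inv ▷ X ⊗≫ (((α_ Z Y X).inv ≫ (β_ Z Y).hom ▷ X ≫ (α_ Y Z X).hom ≫
        Y ◁ (β_ Z X).hom ≫ (α_ Y X Z).inv) ≫ ε ▷ Z) ⊗≫ 𝟙 _ := by
        simp [monoidalComp]
    _ = _ := by rw [← h]; monoidal

theorem whiskerLeft_braiding_inv_ev {X Y : C} (Z : C) (ε : Y ⊗ X ⟶ 𝟙_ C) :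
    Y ◁ (β_ X Z).inv ⊗≫ ε ▷ Z = 𝟙 _ ⊗≫ (β_ Y Z).hom ▷ X ⊗≫ Z ◁ ε ⊗≫ 𝟙 _ := by
  have h := BraidedCategory.braiding_inv_naturality_right Z ε
  rw [BraidedCategory.braiding_tensor_left_inv, braiding_inv_tensorUnit_left] at h
  calc _ = 𝟙 _ ⊗≫ (β_ Y Z).hom ▷ X ⊗≫ (((α_ Z Y X).inv ≫ (β_ Y Z).inv ▷ X ≫ (α_ Y Z X).hom ≫
        Y ◁ (β_ X Z).inv ≫ (α_ Y X Z).inv) ≫ ε ▷ Z) ⊗≫ 𝟙 _ := by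
        simp [monoidalComp]
    _ = _ := by rw [← h]; monoidal

theorem whiskerRight_braiding_coev {X Y : C} (Z : C) (η : 𝟙_ C ⟶ X ⊗ Y) :
    Z ◁ η ⊗≫ (β_ Z X).hom ▷ Y = 𝟙 _ ⊗≫ η ▷ Z ⊗≫ X ◁ (β_ Z Y).inv ⊗≫ 𝟙 _ := by
  have h := BraidedCategory.braiding_naturality_right Z η
  rw [BraidedCategory.braiding_tensor_right_hom, braiding_tensorUnit_right] at h
  calc _ = 𝟙 _ ⊗≫ (Z ◁ η ≫ ((α_ Z X Y).inv ≫ (β_ Z X).hom ▷ Y ≫ (α_ X Z Y).hom ≫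
        X ◁ (β_ Z Y).hom ≫ (α_ X Y Z).inv)) ⊗≫ X ◁ (β_ Z Y).inv ⊗≫ 𝟙 _ := by
        simp [monoidalComp]
    _ = _ := by rw [h]; monoidal

theorem whiskerRight_braiding_inv_coev {X Y : C} (Z : C) (η : 𝟙_ C ⟶ X ⊗ Y) :
    Z ◁ η ⊗≫ (β_ X Z).inv ▷ Y = 𝟙 _ ⊗≫ η ▷ Z ⊗≫ X ◁ (β_ Y Z).hom ⊗≫ 𝟙 _ := by
  have h := BraidedCategory.braiding_inv_naturality_right Z η
  rw [BraidedCategory.braiding_tensor_left_inv, braiding_inv_tensorUnit_left] at h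
  calc _ = 𝟙 _ ⊗≫ (Z ◁ η ≫ ((α_ Z X Y).inv ≫ (β_ X Z).inv ▷ Y ≫ (α_ X Z Y).hom ≫
        X ◁ (β_ Y Z).inv ≫ (α_ X Y Z).inv)) ⊗≫ X ◁ (β_ Y Z).hom ⊗≫ 𝟙 _ := by
        simp [monoidalComp]
    _ = _ := by rw [h]; monoidal

/-- The braiding of `X` with itself and that of `Y` with itself are mates. -/
theorem braiding_mate {X Y : C} (ε : Y ⊗ X ⟶ 𝟙_ C) :
    (β_ Y Y).hom ▷ (X ⊗ X) ≫ nestEv ε ε = (Y ⊗ Y) ◁ (β_ X X).hom ≫ nestEv ε ε := by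
  symm
  calc _ = 𝟙 _ ⊗≫ Y ◁ (Y ◁ (β_ X X).hom ⊗≫ ε ▷ X) ⊗≫ ε := by
        unfold nestEv; monoidal
    _ = 𝟙 _ ⊗≫ Y ◁ (β_ X Y).inv ▷ X ⊗≫ ((Y ⊗ X) ◁ ε ≫ ε ▷ 𝟙_ C) ⊗≫ 𝟙 _ := by
        rw [whiskerLeft_braiding_ev]; monoidal
    _ = 𝟙 _ ⊗≫ (Y ◁ (β_ X Y).inv ⊗≫ ε ▷ Y) ▷ X ⊗≫ ε ⊗≫ 𝟙 _ := by
        rw [whisker_exchange]; monoidal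
    _ = _ := by
        rw [whiskerLeft_braiding_inv_ev]; unfold nestEv; monoidal

variable [BalancedCategory C]

/-- The twist axiom at 𝟙 ⊗ 𝟙 makes the twist of the unit idempotent, and it is invertible. -/
theorem twist_unit : (twist (𝟙_ C)).hom = 𝟙 (𝟙_ C) := by
  have h2 := twist_naturality (λ_ (𝟙_ C)).hom
  have h3 : (twist (𝟙_ C ⊗ 𝟙_ C)).hom ≫ (λ_ (𝟙_ C)).hom =
      (λ_ (𝟙_ C)).hom ≫ (twist (𝟙_ C)).hom ≫ (twist (𝟙_ C)).hom := by
    rw [twist_tensor, MonoidalCategory.tensorHom_def]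
    simp [unitors_equal, unitors_inv_equal]
  rw [h3, cancel_epi] at h2
  rw [← cancel_epi (twist (𝟙_ C)).hom, h2, Category.comp_id]

/-- The counit `X ⊗ Y ⟶ 𝟙_ C` obtained by twisting. -/
def twistEv {X Y : C} (ε : Y ⊗ X ⟶ 𝟙_ C) : X ⊗ Y ⟶ 𝟙_ C :=
  (β_ X Y).hom ≫ Y ◁ (twist X).hom ≫ ε

/-- The unit `𝟙_ C ⟶ Y ⊗ X` obtained by twisting. -/
def twistCoev {X Y : C} (η : 𝟙_ C ⟶ X ⊗ Y) : 𝟙_ C ⟶ Y ⊗ X :=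
  η ≫ X ◁ (twist Y).inv ≫ (β_ Y X).inv

theorem twist_tensor_inv (X Y : C) : (twist (X ⊗ Y)).inv =
    (β_ Y X).inv ≫ ((twist Y).inv ⊗ₘ (twist X).inv) ≫ (β_ X Y).inv :=
  eq_of_inv_eq_inv (by simp [twist_tensor])

theorem twist_inv_naturality {X Y : C} (f : X ⟶ Y) :
    (twist X).inv ≫ f = f ≫ (twist Y).inv := by
  rw [Iso.inv_comp_eq, ← Category.assoc, twist_naturality, Category.assoc, Iso.hom_inv_id,
    Category.comp_id]

theorem twist_tensor_ev {X Y : C} (ε : Y ⊗ X ⟶ 𝟙_ C) : (twist (Y ⊗ X)).hom ≫ ε = ε := by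
  rw [twist_naturality, twist_unit, Category.comp_id]

theorem coev_twist_tensor {X Y : C} (η : 𝟙_ C ⟶ X ⊗ Y) : η ≫ (twist (X ⊗ Y)).hom = η := by
  rw [← twist_naturality, twist_unit, Category.id_comp]

/-- Twisting twice precomposes with the twist of Y ⊗ X, which a map to the unit object absorbs by
naturality. -/
theorem twistEv_twistEv {X Y : C} (ε : Y ⊗ X ⟶ 𝟙_ C) : twistEv (twistEv ε) = ε := by
  conv_rhs => rw [← twist_tensor_ev ε, twist_tensor, MonoidalCategory.tensorHom_def']
  simp [twistEv]

theorem twistCoev_twistCoev {X Y : C} (η : 𝟙_ C ⟶ X ⊗ Y) : twistCoev (twistCoev η) = η := by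
  have h := coev_twist_tensor η
  rw [← cancel_mono (twist (X ⊗ Y)).inv, Category.assoc, Iso.hom_inv_id, Category.comp_id] at h
  conv_rhs => rw [h]
  rw [twist_tensor_inv, MonoidalCategory.tensorHom_def]
  simp [twistCoev]

theorem twistEv_eq {X Y : C} (ε : Y ⊗ X ⟶ 𝟙_ C) :
    twistEv ε = (twist X).hom ▷ Y ≫ (β_ X Y).hom ≫ ε := by
  simp [twistEv]

theorem twistCoev_braiding_inv {X Y : C} (η : 𝟙_ C ⟶ X ⊗ Y) :
    twistCoev η ≫ (β_ X Y).inv = η ≫ (twist X).hom ▷ Y := by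
  conv_rhs => rw [← twistCoev_twistCoev η]
  simp [twistCoev]

/-- The twist of X ⊗ X' consists of two crossings around the twists of its strands. The second
crossing slides through `ε` and becomes an inverse crossing of X' with Y, which cancels one in the
large braiding. The first cancels once X slides through the twisted `ε'`. -/
theorem twistEv_nestEv {X Y X' Y' : C} (ε : Y ⊗ X ⟶ 𝟙_ C) (ε' : Y' ⊗ X' ⟶ 𝟙_ C) :
    twistEv (nestEv ε ε') = nestEv (twistEv ε') (twistEv ε) := by
  calc _ = (β_ X X').hom ▷ (Y' ⊗ Y) ≫ ((twist X').hom ⊗ₘ (twist X).hom) ▷ (Y' ⊗ Y) ≫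
        (β_ (X' ⊗ X) (Y' ⊗ Y)).hom ≫ (𝟙 _ ⊗≫ Y' ◁ (Y ◁ (β_ X' X).hom ⊗≫ ε ▷ X') ⊗≫ ε') := by
        unfold twistEv nestEv
        rw [twist_tensor]
        simp only [BraidedCategory.braiding_naturality_left_assoc]
        monoidal
    _ = (β_ X X').hom ▷ (Y' ⊗ Y) ≫ ((twist X').hom ⊗ₘ (twist X).hom) ▷ (Y' ⊗ Y) ≫
        (𝟙 _ ⊗≫ X' ◁ (β_ X Y').hom ▷ Y ⊗≫ (X' ⊗ Y') ◁ (β_ X Y).hom ⊗≫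
          (β_ X' Y').hom ▷ (Y ⊗ X) ⊗≫
          Y' ◁ ((β_ X' Y).hom ≫ (β_ X' Y).inv) ▷ X ⊗≫ (Y' ⊗ X') ◁ ε ⊗≫ ε') := by
        rw [whiskerLeft_braiding_ev, BraidedCategory.braiding_tensor_left_hom,
          BraidedCategory.braiding_tensor_right_hom, BraidedCategory.braiding_tensor_right_hom]
        monoidal
    _ = 𝟙 _ ⊗≫ (β_ X X').hom ▷ (Y' ⊗ Y) ⊗≫ X' ◁ ((twist X).hom ▷ Y' ≫ (β_ X Y').hom) ▷ Y ⊗≫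
          ((twist X').hom ▷ (Y' ⊗ X ⊗ Y) ≫ X' ◁ Y' ◁ (β_ X Y).hom) ⊗≫
          ((β_ X' Y').hom ▷ (Y ⊗ X) ≫ (Y' ⊗ X') ◁ ε) ⊗≫ ε' := by
        rw [Iso.hom_inv_id, MonoidalCategory.tensorHom_def]
        have e := whisker_exchange (twist X').hom ((twist X).hom ▷ Y' ≫ (β_ X Y').hom)
        calc _ = 𝟙 _ ⊗≫ (β_ X X').hom ▷ (Y' ⊗ Y) ⊗≫ ((twist X').hom ▷ (X ⊗ Y') ≫
              X' ◁ ((twist X).hom ▷ Y' ≫ (β_ X Y').hom)) ▷ Y ⊗≫ (X' ⊗ Y') ◁ (β_ X Y).hom ⊗≫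
              (β_ X' Y').hom ▷ (Y ⊗ X) ⊗≫ (Y' ⊗ X') ◁ ε ⊗≫ ε' := by monoidal
          _ = _ := by rw [← e]; monoidal
    _ = 𝟙 _ ⊗≫ (β_ X X').hom ▷ (Y' ⊗ Y) ⊗≫ X' ◁ (β_ X Y').hom ▷ Y ⊗≫
          (X' ⊗ Y') ◁ ((twist X).hom ▷ Y ≫ (β_ X Y).hom) ⊗≫
          ((twist X').hom ▷ (Y' ⊗ Y ⊗ X) ≫ X' ◁ Y' ◁ ε) ⊗≫ (β_ X' Y').hom ⊗≫ ε' := by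
        rw [BraidedCategory.braiding_naturality_left, ← whisker_exchange, ← whisker_exchange]
        monoidal
    _ = 𝟙 _ ⊗≫ (β_ X X').hom ▷ (Y' ⊗ Y) ⊗≫ X' ◁ (β_ X Y').hom ▷ Y ⊗≫
        ((X' ⊗ Y') ◁ (twistEv ε) ≫ twistEv ε' ▷ 𝟙_ C) ⊗≫ 𝟙 _ := by
        rw [← whisker_exchange, twistEv_eq, twistEv_eq]
        monoidal
    _ = 𝟙 _ ⊗≫ ((β_ X X').hom ▷ Y' ⊗≫ X' ◁ (β_ X Y').hom ⊗≫ twistEv ε' ▷ X) ▷ Y ⊗≫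
       twistEv ε ⊗≫ 𝟙 _ := by
        rw [whisker_exchange]; monoidal
    _ = 𝟙 _ ⊗≫ ((β_ X X').hom ▷ Y' ⊗≫ (β_ X X').inv ▷ Y' ⊗≫ X ◁ twistEv ε') ▷ Y ⊗≫
       twistEv ε ⊗≫ 𝟙 _ := by
        rw [whiskerLeft_braiding_ev]; monoidal
    _ = 𝟙 _ ⊗≫ ((β_ X X').hom ≫ (β_ X X').inv) ▷ Y' ▷ Y ⊗≫ (X ◁ twistEv ε') ▷ Y ⊗≫
       twistEv ε ⊗≫ 𝟙 _ := by
        monoidal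
    _ = _ := by
        rw [Iso.hom_inv_id]; unfold nestEv; monoidal

/-- The trace of `g : X ⟶ Z ⊗ X`, for a unit `η` and a counit `ε` between `X` and `Y`. -/
def pairTrace {X Y Z : C} (η : 𝟙_ C ⟶ X ⊗ Y) (ε : X ⊗ Y ⟶ 𝟙_ C) (g : X ⟶ Z ⊗ X) : 𝟙_ C ⟶ Z :=
  η ≫ g ▷ Y ≫ (α_ Z X Y).hom ≫ Z ◁ ε ≫ (ρ_ Z).hom

/-- Replaced by its mate, `k` slides over the twisted counit, along the dual strand and back through
the unit. As the two dualities are arbitrary, k = 𝟙 also shows that the trace does not depend on the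
choice of dual. -/
theorem pairTrace_cyclic {X Y X' Y' Z : C} {η : 𝟙_ C ⟶ X ⊗ Y} {ε : Y ⊗ X ⟶ 𝟙_ C}
    {η' : 𝟙_ C ⟶ X' ⊗ Y'} {ε' : Y' ⊗ X' ⟶ 𝟙_ C} (h : Zigzag η ε) (h' : Zigzag η' ε')
    (g : X ⟶ Z ⊗ X') (k : X' ⟶ X) :
    pairTrace η (twistEv ε) (g ≫ Z ◁ k) = pairTrace η' (twistEv ε') (k ≫ g) := by
  obtain ⟨m, hm, hm'⟩ := h'.exists_mate h k
  have e : k ▷ Y ≫ twistEv ε = X' ◁ m ≫ twistEv ε' := by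
    simp only [twistEv]
    rw [BraidedCategory.braiding_naturality_left_assoc, ← whiskerLeft_comp_assoc,
      ← twist_naturality, whiskerLeft_comp_assoc, ← hm,
      BraidedCategory.braiding_naturality_right_assoc, whisker_exchange_assoc]
  calc _ = η ≫ g ▷ Y ⊗≫ Z ◁ (k ▷ Y ≫ twistEv ε) ⊗≫ 𝟙 _ := by
        unfold pairTrace; monoidal
    _ = η ≫ (g ▷ Y ≫ (Z ⊗ X') ◁ m) ⊗≫ Z ◁ twistEv ε' ⊗≫ 𝟙 _ := by
        rw [e]; monoidal
    _ = (η ≫ X ◁ m) ≫ g ▷ Y' ⊗≫ Z ◁ twistEv ε' ⊗≫ 𝟙 _ := by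
        rw [← whisker_exchange]; monoidal
    _ = _ := by
        rw [← hm']; unfold pairTrace; monoidal

end Braided

/-! ### Consequences of the ribbon condition -/

section Ribbon

variable {C : Type u} [Category.{v} C] [MonoidalCategory C] [BraidedCategory C]
  [BalancedCategory C]

variable [RightRigidCategory C] [RibbonCategory C]

namespace Zigzag

variable {X Y : C} {η : 𝟙_ C ⟶ X ⊗ Y} {ε : Y ⊗ X ⟶ 𝟙_ C}

/-- The ribbon condition concerns the chosen dual. It passes to any other dual along the comparison
map `g`, which commutes with twists by naturality. -/
theorem twist_ev (h : Zigzag η ε) : (twist Y).hom ▷ X ≫ ε = Y ◁ (twist X).hom ≫ ε := by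
  obtain ⟨g, hg, -⟩ := (zigzag_exactPairing X (Xᘁ : C)).exists_mate h (𝟙 X)
  rw [whiskerLeft_id, Category.id_comp] at hg
  rw [← hg, ← comp_whiskerRight_assoc, twist_naturality, comp_whiskerRight_assoc,
    ← RibbonCategory.twist_dual, rightAdjointMate_comp_evaluation, whisker_exchange_assoc]

theorem coev_twist (h : Zigzag η ε) : η ≫ (twist X).hom ▷ Y = η ≫ X ◁ (twist Y).hom :=
  h.coev_of_ev h.twist_ev

theorem coev_twist_inv (h : Zigzag η ε) : η ≫ (twist X).inv ▷ Y = η ≫ X ◁ (twist Y).inv := by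
  rw [← cancel_mono (X ◁ (twist Y).hom), Category.assoc, ← whisker_exchange, ← Category.assoc,
    ← h.coev_twist]
  simp [← whiskerLeft_comp, ← comp_whiskerRight]

/-- This is the duality swapped by the braiding and transported along the twist of Y; `twist_ev`
moves that twist to X, as `twistEv` requires. -/
theorem twisted (h : Zigzag η ε) : Zigzag (twistCoev η) (twistEv ε) := by
  let := h.exactPairing
  let := BraidedCategory.exactPairing_swap X Y
  have := (zigzag_exactPairing Y X).congr (twist Y).symm (Iso.refl X)
  convert! this using 1
  · change _ = (η ≫ _) ≫ _
    simp [twistCoev]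
  · change _ = _ ≫ (_ ≫ ε)
    simp [twistEv, ← h.twist_ev]

theorem twistCoev_braiding (h : Zigzag η ε) :
    twistCoev η ≫ (β_ Y X).hom = η ≫ (twist X).inv ▷ Y := by
  rw [h.coev_twist_inv]
  simp [twistCoev]

/-- Sliding the strand through `ε` undoes the crossing in the twisted unit and leaves a single
twist, after which a snake equation applies. -/
theorem yank_hom (h : Zigzag η ε) :
    twistCoev η ▷ X ⊗≫ Y ◁ (β_ X X).hom ⊗≫ ε ▷ X = 𝟙 _ ⊗≫ (twist X).hom ⊗≫ 𝟙 _ := by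
  calc _ = 𝟙 _ ⊗≫ (twistCoev η ≫ (β_ X Y).inv) ▷ X ⊗≫ X ◁ ε ⊗≫ 𝟙 _ := by
        rw [whiskerLeft_braiding_ev]; monoidal
    _ = 𝟙 _ ⊗≫ η ▷ X ⊗≫ ((twist X).hom ▷ (Y ⊗ X) ≫ X ◁ ε) ⊗≫ 𝟙 _ := by
        rw [twistCoev_braiding_inv]; monoidal
    _ = 𝟙 _ ⊗≫ (η ▷ X ⊗≫ X ◁ ε) ⊗≫ (twist X).hom ⊗≫ 𝟙 _ := by
        rw [← whisker_exchange]; monoidal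
    _ = _ := by rw [h.ev_coev']; monoidal

theorem yank_inv (h : Zigzag η ε) :
    twistCoev η ▷ X ⊗≫ Y ◁ (β_ X X).inv ⊗≫ ε ▷ X = 𝟙 _ ⊗≫ (twist X).inv ⊗≫ 𝟙 _ := by
  calc _ = 𝟙 _ ⊗≫ (twistCoev η ≫ (β_ Y X).hom) ▷ X ⊗≫ X ◁ ε ⊗≫ 𝟙 _ := by
        rw [whiskerLeft_braiding_inv_ev]; monoidal
    _ = 𝟙 _ ⊗≫ η ▷ X ⊗≫ ((twist X).inv ▷ (Y ⊗ X) ≫ X ◁ ε) ⊗≫ 𝟙 _ := by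
        rw [h.twistCoev_braiding]; monoidal
    _ = 𝟙 _ ⊗≫ (η ▷ X ⊗≫ X ◁ ε) ⊗≫ (twist X).inv ⊗≫ 𝟙 _ := by
        rw [← whisker_exchange]; monoidal
    _ = _ := by rw [h.ev_coev']; monoidal

end Zigzag
end Ribbon

/-! ### The reflexive object: currying, and the trace defining F -/

section Reflexive

variable {C : Type u} [Category.{v} C] [MonoidalCategory C] [BraidedCategory C]
  [BalancedCategory C] [RightRigidCategory C]
variable {A : C} (φ : A ⊗ (Aᘁ : C) ≅ A)

theorem lam_eq : lam φ = 𝟙 _ ⊗≫ A ◁ twistCoev (η_ A (Aᘁ : C)) ⊗≫ φ.hom ▷ A := by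
  simp [lam, twistCoev, monoidalComp]

theorem app_eq : app φ = φ.inv ▷ A ⊗≫ A ◁ ε_ A (Aᘁ : C) ⊗≫ 𝟙 _ := by
  simp [app, monoidalComp]

theorem catTrace_leftUnitor {Z : C} (g : A ⟶ Z ⊗ A) :
    catTrace (X := A) (Y := 𝟙_ C) (Z := Z) ((λ_ A).hom ≫ g) =
      pairTrace (η_ A (Aᘁ : C)) (twistEv (ε_ A (Aᘁ : C))) g := by
  unfold catTrace pairTrace twistEv
  monoidal

/-- Currying along `app`. -/
def curryEquiv (W : C) : (W ⊗ A ⟶ A) ≃ (W ⟶ A) :=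
  (tensorRightHomEquiv W A (Aᘁ : C) A).trans (Iso.homCongr (Iso.refl W) φ)

theorem curryEquiv_symm_apply {W : C} (u : W ⟶ A) :
    (curryEquiv φ W).symm u = u ▷ A ≫ app φ := by
  change ((Iso.refl W).hom ≫ u ≫ φ.inv) ▷ A ≫ (α_ A (Aᘁ : C) A).hom ≫ _ ◁ _ ≫ (ρ_ A).hom = _
  simp [app]

theorem app_cancel {W : C} {f g : W ⟶ A} (h : f ▷ A ≫ app φ = g ▷ A ≫ app φ) : f = g := by
  rw [← curryEquiv_symm_apply, ← curryEquiv_symm_apply] at h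
  exact (curryEquiv φ W).symm.injective h

theorem exists_curry {W : C} (g : W ⊗ A ⟶ A) : ∃ f : W ⟶ A, f ▷ A ≫ app φ = g :=
  ⟨curryEquiv φ W g, by rw [← curryEquiv_symm_apply, Equiv.symm_apply_apply]⟩

theorem appN_cancel (n : ℕ) {W : C} {f g : W ⟶ A}
    (h : f ▷ tpow A n ≫ appN φ n = g ▷ tpow A n ≫ appN φ n) : f = g := by
  induction n generalizing W with
  | zero =>
    change f ▷ 𝟙_ C ≫ (ρ_ A).hom = g ▷ 𝟙_ C ≫ (ρ_ A).hom at h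
    simpa using h
  | succ n ih =>
    change f ▷ (A ⊗ tpow A n) ≫ (α_ A A (tpow A n)).inv ≫ app φ ▷ tpow A n ≫ appN φ n =
      g ▷ (A ⊗ tpow A n) ≫ (α_ A A (tpow A n)).inv ≫ app φ ▷ tpow A n ≫ appN φ n at h
    simp only [associator_inv_naturality_left_assoc, cancel_epi, ← comp_whiskerRight_assoc] at h
    exact app_cancel φ (ih h)

theorem exists_curryN (n : ℕ) {W : C} (g : W ⊗ tpow A n ⟶ A) :
    ∃ f : W ⟶ A, f ▷ tpow A n ≫ appN φ n = g := by
  induction n generalizing W with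
  | zero =>
    change W ⊗ 𝟙_ C ⟶ A at g
    refine ⟨(ρ_ W).inv ≫ g, ?_⟩
    change ((ρ_ W).inv ≫ g) ▷ 𝟙_ C ≫ (ρ_ A).hom = g
    simp
  | succ n ih =>
    change W ⊗ (A ⊗ tpow A n) ⟶ A at g
    obtain ⟨k, hk⟩ := ih ((α_ W A (tpow A n)).hom ≫ g)
    obtain ⟨f, hf⟩ := exists_curry φ k
    refine ⟨f, ?_⟩
    change f ▷ (A ⊗ tpow A n) ≫ (α_ A A (tpow A n)).inv ≫ app φ ▷ tpow A n ≫ appN φ n = g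
    simp only [associator_inv_naturality_left_assoc, ← comp_whiskerRight_assoc, hf, hk]
    simp

/-- The endomorphism `x ↦ a · x` of `A`. -/
def act (a : 𝟙_ C ⟶ A) : A ⟶ A := (λ_ A).inv ≫ a ▷ A ≫ app φ

theorem act_injective {a b : 𝟙_ C ⟶ A} (h : act φ a = act φ b) : a = b := by
  unfold act at h
  rw [cancel_epi] at h
  exact app_cancel φ h

/-- The unit of the self-duality of `A ⊗ A*`. -/
def selfCoev (A : C) : 𝟙_ C ⟶ (A ⊗ (Aᘁ : C)) ⊗ (A ⊗ (Aᘁ : C)) :=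
  nestCoev (η_ A (Aᘁ : C)) (twistCoev (η_ A (Aᘁ : C)))

/-- The counit of the self-duality of `A ⊗ A*`. -/
def selfEv (A : C) : (A ⊗ (Aᘁ : C)) ⊗ (A ⊗ (Aᘁ : C)) ⟶ 𝟙_ C :=
  nestEv (ε_ A (Aᘁ : C)) (twistEv (ε_ A (Aᘁ : C)))

/-- Twisting reverses the nesting and twists each of the two counits, hence exchanges them. -/
theorem twistEv_selfEv : twistEv (selfEv A) = selfEv A := by
  unfold selfEv
  rw [twistEv_nestEv, twistEv_twistEv]

variable [RibbonCategory C]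

theorem zigzag_dual : Zigzag (η_ A (Aᘁ : C)) (ε_ A (Aᘁ : C)) := zigzag_exactPairing A (Aᘁ : C)

theorem zigzag_self : Zigzag (selfCoev A) (selfEv A) :=
  zigzag_dual.nest zigzag_dual.twisted

theorem pairTrace_self {Z : C} (k : A ⟶ Z ⊗ A) :
    pairTrace (η_ A (Aᘁ : C)) (twistEv (ε_ A (Aᘁ : C))) k =
      pairTrace (selfCoev A) (selfEv A) (φ.hom ≫ k ≫ Z ◁ φ.inv) := by
  have h := pairTrace_cyclic (zigzag_dual (A := A)) (zigzag_self (A := A)) (k ≫ Z ◁ φ.inv) φ.hom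
  rw [twistEv_selfEv] at h
  rw [← h]
  simp [← whiskerLeft_comp]

/-- Once the right side is carried along φ to a trace over A ⊗ A*, the two sides are the same
diagram: `lam` and `app` supply the inner loop over A*, and the outer trace the loop over A. -/
theorem pairTrace_lam_app {Z : C} (k : A ⟶ Z ⊗ A) :
    pairTrace (η_ A (Aᘁ : C)) (twistEv (ε_ A (Aᘁ : C)))
        (lam φ ≫ k ▷ A ≫ (α_ Z A A).hom ≫ Z ◁ app φ) =
      pairTrace (η_ A (Aᘁ : C)) (twistEv (ε_ A (Aᘁ : C))) k := by
  rw [pairTrace_self φ k, lam_eq, app_eq]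
  unfold pairTrace selfCoev selfEv nestCoev nestEv
  monoidal

theorem pairTrace_lamN_appN (m : ℕ) {Z : C} (k : A ⟶ Z ⊗ A) :
    pairTrace (η_ A (Aᘁ : C)) (twistEv (ε_ A (Aᘁ : C)))
        (lamN φ m ≫ k ▷ tpow A m ≫ (α_ Z A (tpow A m)).hom ≫ Z ◁ appN φ m) =
      pairTrace (η_ A (Aᘁ : C)) (twistEv (ε_ A (Aᘁ : C))) k := by
  induction m generalizing k with
  | zero =>
    congr 1
    change (ρ_ A).inv ≫ k ▷ 𝟙_ C ≫ (α_ Z A (𝟙_ C)).hom ≫ Z ◁ (ρ_ A).hom = k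
    monoidal
  | succ m ih =>
    rw [← pairTrace_lam_app φ k, ← ih (lam φ ≫ k ▷ A ≫ (α_ Z A A).hom ≫ Z ◁ app φ)]
    congr 1
    change (lamN φ m ≫ lam φ ▷ tpow A m ≫ (α_ A A (tpow A m)).hom) ≫ k ▷ (A ⊗ tpow A m) ≫
      (α_ Z A (A ⊗ tpow A m)).hom ≫
      Z ◁ ((α_ A A (tpow A m)).inv ≫ app φ ▷ tpow A m ≫ appN φ m) = _
    monoidal

/-- By cyclicity `u` moves in front of `lam`. The snake equation of the twisted duality then
straightens the loop of the trace, and that of the chosen duality the strand evaluated by `app`. -/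
theorem act_pairTrace_lam (u : A ⟶ A) :
    act φ (pairTrace (η_ A (Aᘁ : C)) (twistEv (ε_ A (Aᘁ : C))) (lam φ ≫ A ◁ u)) = u := by
  have h := zigzag_dual (A := A)
  rw [pairTrace_cyclic h h, lam_eq]
  unfold act pairTrace
  calc _ = 𝟙 _ ⊗≫ (η_ A (Aᘁ : C) ≫ u ▷ (Aᘁ : C)) ▷ A ⊗≫
        A ◁ (twistCoev (η_ A (Aᘁ : C)) ▷ (Aᘁ : C) ⊗≫
          (Aᘁ : C) ◁ twistEv (ε_ A (Aᘁ : C))) ▷ A ⊗≫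
        (φ.hom ▷ A ≫ app φ) := by
        have e := whisker_exchange φ.hom (twistEv (ε_ A (Aᘁ : C)))
        calc _ = 𝟙 _ ⊗≫ (η_ A (Aᘁ : C) ≫ u ▷ (Aᘁ : C)) ▷ A ⊗≫
              (A ◁ twistCoev (η_ A (Aᘁ : C)) ▷ (Aᘁ : C)) ▷ A ⊗≫
              (φ.hom ▷ (A ⊗ (Aᘁ : C)) ≫ A ◁ twistEv (ε_ A (Aᘁ : C))) ▷ A ⊗≫ app φ := by
              monoidal
          _ = _ := by rw [← e]; monoidal
    _ = 𝟙 _ ⊗≫ η_ A (Aᘁ : C) ▷ A ⊗≫ (u ▷ ((Aᘁ : C) ⊗ A) ≫ A ◁ ε_ A (Aᘁ : C)) ⊗≫ 𝟙 _ := by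
        rw [h.twisted.ev_coev', app_eq]
        calc _ = 𝟙 _ ⊗≫ (η_ A (Aᘁ : C) ≫ u ▷ (Aᘁ : C)) ▷ A ⊗≫
              (φ.hom ≫ φ.inv) ▷ A ⊗≫ A ◁ ε_ A (Aᘁ : C) ⊗≫ 𝟙 _ := by monoidal
          _ = _ := by rw [φ.hom_inv_id]; monoidal
    _ = 𝟙 _ ⊗≫ (η_ A (Aᘁ : C) ▷ A ⊗≫ A ◁ ε_ A (Aᘁ : C)) ⊗≫ u ⊗≫ 𝟙 _ := by
        rw [← whisker_exchange]; monoidal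
    _ = u := by
        rw [h.ev_coev']; monoidal

/-- This says that F(f) k x = k (f x), for x a list of m arguments. -/
theorem act_F {m n : ℕ} (f : tpow A m ⟶ tpow A n) :
    act φ (F φ f) ▷ tpow A m ≫ appN φ m = A ◁ f ≫ appN φ n := by
  -- The map `u` is k ↦ (x ↦ k (f x)), curried. With it the body of the trace has the form lam_m ;
  -- (lam ; A ◁ u) ▷ A^m ; A ◁ app_m, from which lam_m and app_m can be dropped.
  obtain ⟨u, hu⟩ := exists_curryN φ m (A ◁ f ≫ appN φ n)
  have : F φ f = pairTrace (η_ A (Aᘁ : C)) (twistEv (ε_ A (Aᘁ : C))) (lam φ ≫ A ◁ u) := by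
    unfold F
    rw [catTrace_leftUnitor, ← pairTrace_lamN_appN φ m (lam φ ≫ A ◁ u)]
    congr 1
    calc _ = lamN φ m ≫ lam φ ▷ tpow A m ≫ (α_ A A (tpow A m)).hom ≫
          A ◁ (A ◁ f ≫ appN φ n) := by
          rw [MonoidalCategory.tensorHom_def]; monoidal
      _ = _ := by rw [← hu]; monoidal
  rw [this, act_pairTrace_lam, hu]

/-- Each `lam` contributes a twisted unit and a φ. The loop of the trace is a snake that absorbs one
of the two twisted units; the other remains nested inside η. -/
theorem dualUnit_eq : dualUnit φ = selfCoev A ≫ (φ.hom ⊗ₘ φ.hom) := by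
  unfold dualUnit
  have h := zigzag_dual (A := A)
  rw [catTrace_leftUnitor, lam_eq]
  unfold pairTrace
  calc _ = 𝟙 _ ⊗≫ η_ A (Aᘁ : C) ⊗≫ A ◁ twistCoev (η_ A (Aᘁ : C)) ▷ (Aᘁ : C) ⊗≫
        (φ.hom ▷ ((A ⊗ 𝟙_ C) ⊗ (Aᘁ : C)) ≫ A ◁ ((A ◁ (twistCoev (η_ A (Aᘁ : C)))) ▷ (Aᘁ : C))) ⊗≫
         A ◁ (φ.hom ▷ (A ⊗ (Aᘁ : C)) ≫ A ◁ twistEv (ε_ A (Aᘁ : C))) ⊗≫ 𝟙 _ := by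
        monoidal
    _ = 𝟙 _ ⊗≫ η_ A (Aᘁ : C) ⊗≫ A ◁ twistCoev (η_ A (Aᘁ : C)) ▷ (Aᘁ : C) ⊗≫
        (((A ⊗ (Aᘁ : C)) ⊗ A) ◁ (twistCoev (η_ A (Aᘁ : C)) ▷ (Aᘁ : C) ⊗≫
          (Aᘁ : C) ◁ twistEv (ε_ A (Aᘁ : C)))) ⊗≫ (φ.hom ▷ (A ⊗ (Aᘁ : C)) ≫ A ◁ φ.hom) := by
        rw [← whisker_exchange φ.hom (twistEv (ε_ A (Aᘁ : C))), ← whisker_exchange]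
        have e := whisker_exchange φ.hom (A ◁ (Aᘁ : C) ◁ twistEv (ε_ A (Aᘁ : C)))
        calc _ = 𝟙 _ ⊗≫ η_ A (Aᘁ : C) ⊗≫ A ◁ twistCoev (η_ A (Aᘁ : C)) ▷ (Aᘁ : C) ⊗≫
              (A ⊗ (Aᘁ : C)) ◁ A ◁ (twistCoev (η_ A (Aᘁ : C)) ▷ (Aᘁ : C)) ⊗≫
              (φ.hom ▷ (A ⊗ (Aᘁ : C) ⊗ A ⊗ (Aᘁ : C)) ≫
              A ◁ A ◁ (Aᘁ : C) ◁ twistEv (ε_ A (Aᘁ : C))) ⊗≫ A ◁ φ.hom ⊗≫ 𝟙 _ := by monoidal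
          _ = _ := by rw [← e]; monoidal
    _ = _ := by
        rw [h.twisted.ev_coev', MonoidalCategory.tensorHom_def]
        unfold selfCoev nestCoev
        monoidal

theorem dualCounit_eq : dualCounit φ = (φ.inv ⊗ₘ φ.inv) ≫ selfEv A := by
  have h := zigzag_dual (A := A)
  unfold dualCounit catTrace
  rw [app_eq]
  calc _ = 𝟙 _ ⊗≫ ((A ⊗ A) ◁ η_ A (Aᘁ : C) ≫ (A ◁ φ.inv) ▷ (A ⊗ (Aᘁ : C))) ⊗≫
        A ◁ A ◁ ε_ A (Aᘁ : C) ▷ (Aᘁ : C) ⊗≫ φ.inv ▷ (A ⊗ (Aᘁ : C)) ⊗≫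
        A ◁ ε_ A (Aᘁ : C) ▷ (Aᘁ : C) ⊗≫ twistEv (ε_ A (Aᘁ : C)) := by
        unfold twistEv; monoidal
    _ = 𝟙 _ ⊗≫ A ◁ φ.inv ⊗≫ (A ⊗ A) ◁ ((Aᘁ : C) ◁ η_ A (Aᘁ : C) ⊗≫
        ε_ A (Aᘁ : C) ▷ (Aᘁ : C)) ⊗≫ φ.inv ▷ (A ⊗ (Aᘁ : C)) ⊗≫
        A ◁ ε_ A (Aᘁ : C) ▷ (Aᘁ : C) ⊗≫ twistEv (ε_ A (Aᘁ : C)) := by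
        rw [whisker_exchange]; monoidal
    _ = _ := by
        rw [h.coev_ev', MonoidalCategory.tensorHom_def']
        unfold selfEv nestEv
        monoidal

end Reflexive

/-! ### The calculus of represented morphisms, and the balanced axioms -/

section Representation

variable {C : Type u} [Category.{v} C] [MonoidalCategory C] [BraidedCategory C]
  [BalancedCategory C] [RightRigidCategory C]
variable {A : C} (φ : A ⊗ (Aᘁ : C) ≅ A)

theorem ap_eq (a b : 𝟙_ C ⟶ A) : (reflexiveAlgebra φ).ap a b = b ≫ act φ a := by
  change (λ_ (𝟙_ C)).inv ≫ (a ⊗ₘ b) ≫ app φ = b ≫ (λ_ A).inv ≫ a ▷ A ≫ app φ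
  rw [MonoidalCategory.tensorHom_def']
  simp

theorem act_eq_ap {a b : 𝟙_ C ⟶ A} : act φ ((reflexiveAlgebra φ).ap a b) =
    (λ_ A).inv ≫ b ▷ A ≫ act φ a ▷ A ≫ app φ := by
  rw [ap_eq, act, comp_whiskerRight_assoc]

/-- The evaluation `A ⊗ (X ⊗ Y) ⟶ A` applying first the arguments in `X` and then those in `Y`. -/
def evTensor {X Y : C} (p : A ⊗ X ⟶ A) (q : A ⊗ Y ⟶ A) : A ⊗ (X ⊗ Y) ⟶ A :=
  (α_ A X Y).inv ≫ p ▷ Y ≫ q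

/-- An evaluation along which currying is injective. -/
def Cancels {X : C} (p : A ⊗ X ⟶ A) : Prop :=
  ∀ (W : C) (f g : W ⟶ A), f ▷ X ≫ p = g ▷ X ≫ p → f = g

theorem cancels_app : Cancels (app φ) := fun _ _ _ h => app_cancel φ h

theorem cancels_appN (n : ℕ) : Cancels (appN φ n) := fun _ _ _ h => appN_cancel φ n h

theorem cancels_unit : Cancels (ρ_ A).hom := fun _ _ _ h => by simpa using h

theorem Cancels.tensor {X Y : C} {p : A ⊗ X ⟶ A} {q : A ⊗ Y ⟶ A} (hp : Cancels p)
    (hq : Cancels q) : Cancels (evTensor p q) := by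
  intro W f g h
  unfold evTensor at h
  simp only [associator_inv_naturality_left_assoc, cancel_epi, ← comp_whiskerRight_assoc] at h
  exact hp _ _ _ (hq _ _ _ h)

/-- The element `a` represents `f : X ⟶ Y`: `a k x = k (f x)`. -/
def Rep {X Y : C} (p : A ⊗ X ⟶ A) (q : A ⊗ Y ⟶ A) (f : X ⟶ Y) (a : 𝟙_ C ⟶ A) : Prop :=
  act φ a ▷ X ≫ p = A ◁ f ≫ q

variable {φ}

/-- The device for proving equations of combinators: exhibit what both sides represent and compare
in the category. -/
theorem Rep.eq {X Y : C} {p : A ⊗ X ⟶ A} {q : A ⊗ Y ⟶ A} {f g : X ⟶ Y} {a b : 𝟙_ C ⟶ A}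
    (ha : Rep φ p q f a) (hb : Rep φ p q g b) (hp : Cancels p) (h : f = g) : a = b := by
  subst h
  exact act_injective φ (hp _ _ _ (Eq.trans ha (Eq.symm hb)))

/-- Arguments beyond those in X are passed on untouched, which is why a + m' is just a in the
internal PRO. -/
theorem Rep.whiskerRight {X Y Z : C} {p : A ⊗ X ⟶ A} {q : A ⊗ Y ⟶ A} {f : X ⟶ Y}
    {a : 𝟙_ C ⟶ A} (ha : Rep φ p q f a) (r : A ⊗ Z ⟶ A) :
    Rep φ (evTensor p r) (evTensor q r) (f ▷ Z) a := by
  unfold Rep evTensor at *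
  rw [associator_inv_naturality_left_assoc, ← comp_whiskerRight_assoc, ha]
  monoidal

theorem Rep.assoc_left {X Y Z W : C} {p : A ⊗ X ⟶ A} {q : A ⊗ Y ⟶ A} {r : A ⊗ Z ⟶ A}
    {s : A ⊗ W ⟶ A} {f : (X ⊗ Y) ⊗ Z ⟶ W} {a : 𝟙_ C ⟶ A}
    (ha : Rep φ (evTensor (evTensor p q) r) s f a) :
    Rep φ (evTensor p (evTensor q r)) s ((α_ X Y Z).inv ≫ f) a := by
  unfold Rep evTensor at *
  rw [whiskerLeft_comp, Category.assoc, ← ha]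
  calc _ = 𝟙 _ ⊗≫ act φ a ▷ ((X ⊗ Y) ⊗ Z) ⊗≫ p ▷ Y ▷ Z ⊗≫ q ▷ Z ⊗≫ r := by monoidal
    _ = _ := by monoidal

theorem Rep.assoc_right {X Y Z W : C} {p : A ⊗ X ⟶ A} {q : A ⊗ Y ⟶ A} {r : A ⊗ Z ⟶ A}
    {s : A ⊗ W ⟶ A} {f : W ⟶ (X ⊗ Y) ⊗ Z} {a : 𝟙_ C ⟶ A}
    (ha : Rep φ s (evTensor (evTensor p q) r) f a) :
    Rep φ s (evTensor p (evTensor q r)) (f ≫ (α_ X Y Z).hom) a := by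
  unfold Rep evTensor at *
  rw [ha]
  monoidal

theorem Rep.unit_left {X Y : C} {p : A ⊗ X ⟶ A} {q : A ⊗ Y ⟶ A} {f : 𝟙_ C ⊗ X ⟶ Y}
    {a : 𝟙_ C ⟶ A} (ha : Rep φ (evTensor (ρ_ A).hom p) q f a) :
    Rep φ p q ((λ_ X).inv ≫ f) a := by
  unfold Rep evTensor at *
  rw [whiskerLeft_comp, Category.assoc, ← ha]
  monoidal

theorem Rep.right_unit {X Y : C} {p : A ⊗ X ⟶ A} {q : A ⊗ Y ⟶ A} {f : Y ⟶ 𝟙_ C ⊗ X}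
    {a : 𝟙_ C ⟶ A} (ha : Rep φ q (evTensor (ρ_ A).hom p) f a) :
    Rep φ q p (f ≫ (λ_ X).hom) a := by
  unfold Rep evTensor at *
  rw [ha]
  monoidal

theorem Rep.left_unit' {X Y : C} {p : A ⊗ X ⟶ A} {q : A ⊗ Y ⟶ A} {f : X ⊗ 𝟙_ C ⟶ Y}
    {a : 𝟙_ C ⟶ A} (ha : Rep φ (evTensor p (ρ_ A).hom) q f a) :
    Rep φ p q ((ρ_ X).inv ≫ f) a := by
  unfold Rep evTensor at *
  rw [whiskerLeft_comp, Category.assoc, ← ha]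
  monoidal

theorem Rep.right_unit' {X Y : C} {p : A ⊗ X ⟶ A} {q : A ⊗ Y ⟶ A} {f : Y ⟶ X ⊗ 𝟙_ C}
    {a : 𝟙_ C ⟶ A} (ha : Rep φ q (evTensor p (ρ_ A).hom) f a) :
    Rep φ q p (f ≫ (ρ_ X).hom) a := by
  unfold Rep evTensor at *
  rw [ha]
  monoidal

theorem Rep.act_ap {X Y : C} {p : A ⊗ X ⟶ A} {q : A ⊗ Y ⟶ A} {f : A ⊗ X ⟶ Y}
    {a : 𝟙_ C ⟶ A} (ha : Rep φ (evTensor (app φ) p) q f a) (b : 𝟙_ C ⟶ A) :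
    act φ ((reflexiveAlgebra φ).ap a b) ▷ X ≫ p = f ≫ (λ_ Y).inv ≫ b ▷ Y ≫ q := by
  rw [act_eq_ap]
  unfold Rep evTensor at ha
  calc _ = 𝟙 _ ⊗≫ b ▷ (A ⊗ X) ⊗≫
        (act φ a ▷ (A ⊗ X) ≫ (α_ A A X).inv ≫ app φ ▷ X ≫ p) := by monoidal
    _ = 𝟙 _ ⊗≫ (b ▷ (A ⊗ X) ≫ A ◁ f) ⊗≫ q := by rw [ha]; monoidal
    _ = _ := by rw [← whisker_exchange]; monoidal

variable [RibbonCategory C]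

theorem rep_F {m n : ℕ} (f : tpow A m ⟶ tpow A n) : Rep φ (appN φ m) (appN φ n) f (F φ f) :=
  act_F φ f

theorem rep_F_conj {m n : ℕ} {X Y : C} {p : A ⊗ X ⟶ A} {q : A ⊗ Y ⟶ A} (e : tpow A m ≅ X)
    (e' : tpow A n ≅ Y) (hp : appN φ m = A ◁ e.hom ≫ p) (hq : appN φ n = A ◁ e'.hom ≫ q)
    (f : X ⟶ Y) : Rep φ p q f (F φ (e.hom ≫ f ≫ e'.inv)) := by
  have h := act_F φ (e.hom ≫ f ≫ e'.inv)
  rw [hp, hq, ← whisker_exchange_assoc] at h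
  unfold Rep
  rw [← cancel_epi (A ◁ e.hom), h]
  simp only [← whiskerLeft_comp_assoc, Category.assoc, Iso.inv_hom_id, Category.comp_id]

theorem appN_zero :
    appN φ 0 = A ◁ (Iso.refl (𝟙_ C) : tpow A 0 ≅ 𝟙_ C).hom ≫ (ρ_ A).hom := by
  change (ρ_ A).hom = A ◁ 𝟙 (𝟙_ C) ≫ (ρ_ A).hom
  simp

theorem appN_one : appN φ 1 = A ◁ (tpowOne A).hom ≫ app φ := by
  change (α_ A A (𝟙_ C)).inv ≫ app φ ▷ 𝟙_ C ≫ (ρ_ A).hom = A ◁ (ρ_ A).hom ≫ app φ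
  monoidal

theorem appN_two : appN φ 2 = A ◁ (tpowTwo A).hom ≫ evTensor (app φ) (app φ) := by
  change (α_ A A (A ⊗ 𝟙_ C)).inv ≫ app φ ▷ (A ⊗ 𝟙_ C) ≫ appN φ 1 =
    A ◁ (A ◁ (ρ_ A).hom) ≫ (α_ A A A).inv ≫ app φ ▷ A ≫ app φ
  rw [appN_one]
  change (α_ A A (A ⊗ 𝟙_ C)).inv ≫ app φ ▷ (A ⊗ 𝟙_ C) ≫ A ◁ (ρ_ A).hom ≫ app φ = _
  rw [← whisker_exchange_assoc]
  monoidal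

theorem rep_B : Rep φ (evTensor (app φ) (app φ)) (app φ) (app φ) (reflexiveAlgebra φ).B :=
  rep_F_conj (m := 2) (n := 1) (tpowTwo A) (tpowOne A) appN_two appN_one _

theorem rep_C (s : Bool) : Rep φ (evTensor (app φ) (app φ)) (evTensor (app φ) (app φ))
    (if s then (β_ A A).hom else (β_ A A).inv) ((reflexiveAlgebra φ).C s) :=
  rep_F_conj (m := 2) (n := 2) (tpowTwo A) (tpowTwo A) appN_two appN_two _

theorem rep_theta (s : Bool) : Rep φ (app φ) (app φ)
    (if s then (twist A).hom else (twist A).inv) ((reflexiveAlgebra φ).θ s) :=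
  rep_F_conj (m := 1) (n := 1) (tpowOne A) (tpowOne A) appN_one appN_one _

theorem rep_traceComb : Rep φ (app φ) (evTensor (app φ) (app φ)) (lam φ) (traceComb φ) :=
  rep_F_conj (m := 1) (n := 2) (tpowOne A) (tpowTwo A) appN_one appN_two _

theorem rep_FElem (a : 𝟙_ C ⟶ A) : Rep φ (ρ_ A).hom (app φ) a (FElem φ a) := by
  have := rep_F_conj (φ := φ) (m := 0) (n := 1) (p := (ρ_ A).hom) 
    (Iso.refl (𝟙_ C) : tpow A 0 ≅ 𝟙_ C) (tpowOne A) appN_zero appN_one a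
  exact (congrArg (fun f => Rep φ _ _ a (F φ (m := 0) (n := 1) f)) (Category.id_comp _)).mp this

theorem rep_alphaComb : Rep φ (ρ_ A).hom (evTensor (app φ) (app φ)) (dualUnit φ)
    (alphaComb φ) := by
  have := rep_F_conj (φ := φ) (m := 0) (n := 2) (p := (ρ_ A).hom) 
    (Iso.refl (𝟙_ C) : tpow A 0 ≅ 𝟙_ C) (tpowTwo A) appN_zero appN_two (dualUnit φ)
  exact (congrArg (fun f => Rep φ _ _ (dualUnit φ) (F φ (m := 0) (n := 2) f))
    (Category.id_comp _)).mp this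

theorem rep_betaComb : Rep φ (evTensor (app φ) (app φ)) (ρ_ A).hom (dualCounit φ)
    (betaComb φ) := by
  have := rep_F_conj (φ := φ) (m := 2) (n := 0) (q := (ρ_ A).hom) (tpowTwo A)
    (Iso.refl (𝟙_ C) : tpow A 0 ≅ 𝟙_ C) appN_two appN_zero (dualCounit φ)
  exact (congrArg (fun f => Rep φ _ _ (dualCounit φ) (F φ (m := 2) (n := 0) f))
    (Category.comp_id ((tpowTwo A).hom ≫ dualCounit φ))).mp
      (by rw [Category.assoc]; exact this)

theorem act_I : act φ (reflexiveAlgebra φ).I = 𝟙 A := by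
  have h := act_F φ (𝟙 (tpow A 0))
  refine cancels_appN φ 0 _ _ _ ?_
  rw [whiskerLeft_id] at h
  rw [id_whiskerRight]
  exact h

theorem rep_I {X : C} (p : A ⊗ X ⟶ A) : Rep φ p p (𝟙 X) (reflexiveAlgebra φ).I := by
  simp [Rep, act_I]

theorem act_ap_B (a : 𝟙_ C ⟶ A) :
    act φ ((reflexiveAlgebra φ).ap (reflexiveAlgebra φ).B a) ▷ A ≫ app φ = app φ ≫ act φ a :=
  rep_B.act_ap a

theorem act_comp (a b : 𝟙_ C ⟶ A) :
    act φ ((reflexiveAlgebra φ).comp a b) = act φ b ≫ act φ a := by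
  unfold BalancedData.comp
  rw [act_eq_ap, act_ap_B]
  simp [act]

/-- The rule C a b k = a k b. The sign is immaterial because b starts at the unit object, where
crossings are trivial. -/
theorem act_ap_ap_C (t : Bool) (a b : 𝟙_ C ⟶ A) :
    act φ ((reflexiveAlgebra φ).ap ((reflexiveAlgebra φ).ap ((reflexiveAlgebra φ).C t) a) b) =
      (ρ_ A).inv ≫ A ◁ b ≫ act φ a ▷ A ≫ app φ := by
  rw [act_eq_ap, (rep_C t).act_ap a]
  have h : (λ_ (A ⊗ A)).inv ≫ a ▷ (A ⊗ A) ≫ evTensor (app φ) (app φ) = act φ a ▷ A ≫ app φ := by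
    unfold act evTensor
    monoidal
  rw [h]
  cases t <;> simp

/-- Since a (b k) x = b k (f x) = k (g (f x)); taking continuations reverses the order, so ∘ matches
diagrammatic composition. -/
theorem Rep.comp {X Y Z : C} {p : A ⊗ X ⟶ A} {q : A ⊗ Y ⟶ A} {r : A ⊗ Z ⟶ A} {f : X ⟶ Y}
    {g : Y ⟶ Z} {a b : 𝟙_ C ⟶ A} (ha : Rep φ p q f a) (hb : Rep φ q r g b) :
    Rep φ p r (f ≫ g) ((reflexiveAlgebra φ).comp a b) := by
  unfold Rep at *
  rw [act_comp, comp_whiskerRight_assoc, ha, ← whisker_exchange_assoc, hb,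
    whiskerLeft_comp_assoc]

/-- Since B a k y x = a (k y) x = k y (f x). -/
theorem Rep.lift {X Y : C} {p : A ⊗ X ⟶ A} {q : A ⊗ Y ⟶ A} {f : X ⟶ Y} {a : 𝟙_ C ⟶ A}
    (ha : Rep φ p q f a) : Rep φ (evTensor (app φ) p) (evTensor (app φ) q) (A ◁ f)
      ((reflexiveAlgebra φ).ap (reflexiveAlgebra φ).B a) := by
  unfold Rep evTensor at *
  calc _ = 𝟙 _ ⊗≫ (act φ ((reflexiveAlgebra φ).ap (reflexiveAlgebra φ).B a) ▷ A ≫ app φ) ▷ X ⊗≫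
        p := by monoidal
    _ = 𝟙 _ ⊗≫ app φ ▷ X ⊗≫ (act φ a ▷ X ≫ p) := by rw [act_ap_B]; monoidal
    _ = 𝟙 _ ⊗≫ (app φ ▷ X ≫ A ◁ f) ⊗≫ q := by rw [ha]; monoidal
    _ = _ := by rw [← whisker_exchange]; monoidal

theorem rep_CB (t : Bool) (a : 𝟙_ C ⟶ A) : Rep φ (app φ) (app φ) (act φ a)
    ((reflexiveAlgebra φ).ap ((reflexiveAlgebra φ).ap ((reflexiveAlgebra φ).C t)
      (reflexiveAlgebra φ).B) a) := by
  have h := rep_B (φ := φ)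
  unfold Rep evTensor at *
  rw [act_ap_ap_C]
  calc _ = 𝟙 _ ⊗≫ (A ◁ a ≫ act φ (reflexiveAlgebra φ).B ▷ A) ▷ A ⊗≫ app φ ▷ A ⊗≫ app φ := by
        monoidal
    _ = 𝟙 _ ⊗≫ A ◁ a ▷ A ⊗≫
      (act φ (reflexiveAlgebra φ).B ▷ (A ⊗ A) ≫ (α_ A A A).inv ≫ app φ ▷ A ≫ app φ) := by
        monoidal
    _ = _ := by
        rw [h]
        unfold act
        monoidal

theorem rep_CI (t : Bool) (a : 𝟙_ C ⟶ A) : Rep φ (ρ_ A).hom (app φ) a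
    ((reflexiveAlgebra φ).ap ((reflexiveAlgebra φ).ap ((reflexiveAlgebra φ).C t)
      (reflexiveAlgebra φ).I) a) := by
  unfold Rep
  rw [act_ap_ap_C, act_I]
  simp

theorem ap_B_I : (reflexiveAlgebra φ).ap (reflexiveAlgebra φ).B (reflexiveAlgebra φ).I =
    (reflexiveAlgebra φ).I :=
  (rep_I (app φ)).lift.eq (rep_I _) ((cancels_app φ).tensor (cancels_app φ)) (by simp)

theorem isExtensional : (reflexiveAlgebra φ).IsExtensional := by
  have c1 := cancels_app φ
  have c2 := c1.tensor c1
  have c3 := c1.tensor c2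
  have hB := rep_B (φ := φ)
  have hBB := ((hB.whiskerRight (app φ)).comp hB).assoc_left
  constructor
  · intro a b c
    have := act_comp (φ := φ) a b
    unfold BalancedData.comp at this
    rw [ap_eq, this, ap_eq, ap_eq, Category.assoc]
  · intro t a b c
    have h : c ≫ (ρ_ A).inv ≫ A ◁ b = b ≫ (λ_ A).inv ≫ c ▷ A := by
      rw [rightUnitor_inv_naturality_assoc, leftUnitor_inv_naturality_assoc, whisker_exchange,
        unitors_inv_equal]
    rw [ap_eq, act_ap_ap_C, ap_eq, act_eq_ap, reassoc_of% h]
  · intro a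
    rw [ap_eq, act_I, Category.comp_id]
  · intro a b
    exact act_injective φ (by rw [act_ap_ap_C, act_ap_ap_C])
  · exact ap_B_I
  · intro t
    rw [ap_B_I]
    exact (rep_CB t _).eq (rep_I _) c1 act_I
  · intro t
    -- The remaining equation of morphisms is literally the statement that B represents `app`. The
    -- second coxeter axiom below uses `rep_C` in the same way.
    exact (((rep_CB t _).whiskerRight (evTensor (app φ) (app φ))).comp hBB).eq
      (hB.lift.comp hB) c3 hB
  · intro s
    rw [ap_B_I, ap_B_I]
    exact ((rep_C s).comp (rep_C (!s))).eq (rep_I _) c2 (by cases s <;> simp)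
  · intro t s
    exact (((rep_CB t _).whiskerRight (evTensor (app φ) (app φ))).comp hBB).eq
      ((rep_C s).lift.comp hBB) c3 (rep_C s)
  · intro s
    have hC := (((rep_C (φ := φ) s).whiskerRight (app φ)).assoc_left).assoc_right
    refine ((rep_C s).lift.comp (hC.comp (rep_C s).lift)).eq
      (hC.comp ((rep_C s).lift.comp hC)) c3 ?_
    cases s
    -- For the negative sign, Yang–Baxter is inverted.
    · have h := congrArg Iso.inv (BraidedCategory.yang_baxter_iso A A A)
      simp only [Iso.trans_inv, Iso.symm_inv, whiskerLeftIso_inv, whiskerRightIso_inv,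
        Category.assoc] at h
      simpa using h.symm
    · simpa using (BraidedCategory.yang_baxter A A A).symm
  · intro s
    have hC := (((rep_C (φ := φ) s).whiskerRight (app φ)).assoc_left).assoc_right
    refine (hB.lift.comp (rep_C s)).eq
      (hC.comp ((rep_C s).lift.comp (hB.whiskerRight (app φ)).assoc_left)) c3 ?_
    cases s <;> simp

theorem isBalanced : (reflexiveAlgebra φ).IsBalanced where
  toIsExtensional := isExtensional
  ax_theta1 t s := by
    have c1 := cancels_app φ
    exact ((rep_theta s).lift.comp rep_B).eq
      (((rep_CB t _).whiskerRight (app φ)).comp rep_B) (c1.tensor c1) (rep_theta s).symm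
  ax_theta2 s := by
    rw [ap_B_I]
    exact ((rep_theta s).comp (rep_theta (!s))).eq (rep_I _) (cancels_app φ) (by cases s <;> simp)
  ax_theta3 t s t' a := by
    refine act_injective φ ?_
    rw [act_ap_ap_C, act_ap_ap_C, act_I]
    have h := rep_theta (φ := φ) s
    unfold Rep at h
    -- An element absorbs the twist, since the twist of the unit object is trivial.
    have h2 := twist_naturality a
    rw [twist_unit, Category.id_comp] at h2
    rw [h, ← whiskerLeft_comp_assoc, id_whiskerRight, Category.id_comp]
    congr 3
    cases s
    · simp [← cancel_mono (twist A).hom, ← h2]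
    · exact h2.symm
  ax_theta4 s := by
    have c1 := cancels_app φ
    have hθ := (rep_theta (φ := φ) s).whiskerRight (app φ)
    refine (rep_B.comp (rep_theta s)).eq
      (hθ.comp ((rep_C s).comp (hθ.comp ((rep_C s).comp rep_B)))) (c1.tensor c1) ?_
    cases s
    · simp only [Bool.false_eq_true, if_false]
      rw [← twist_inv_naturality, twist_tensor_inv, MonoidalCategory.tensorHom_def']
      simp
    · simp only [if_true]
      rw [← twist_naturality, twist_tensor, MonoidalCategory.tensorHom_def']
      simp

end Representation

/-! ### The trace combinator -/

section Traced

variable {C : Type u} [Category.{v} C] [MonoidalCategory C] [BraidedCategory C]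
  [BalancedCategory C] [RightRigidCategory C] [RibbonCategory C]
variable {A : C} (φ : A ⊗ (Aᘁ : C) ≅ A)

theorem zigzag_dualUnit : Zigzag (dualUnit φ) (dualCounit φ) := by
  rw [dualUnit_eq, dualCounit_eq]
  exact zigzag_self.congr φ φ

theorem twistEv_dualCounit : twistEv (dualCounit φ) = dualCounit φ := by
  rw [dualCounit_eq]
  conv_rhs => rw [← twistEv_selfEv]
  unfold twistEv
  rw [BraidedCategory.braiding_naturality_assoc]
  simp only [MonoidalCategory.tensorHom_def, Category.assoc]
  rw [whisker_exchange_assoc, ← whiskerLeft_comp_assoc, ← whiskerLeft_comp_assoc,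
    twist_naturality]

/-- The twisted duality has the same counit, and the counit determines the unit. -/
theorem twistCoev_dualUnit : twistCoev (dualUnit φ) = dualUnit φ := by
  have h := (zigzag_dualUnit φ).twisted
  rw [twistEv_dualCounit] at h
  exact h.unique_coev (zigzag_dualUnit φ)

theorem hom_whiskerRight_app :
    φ.hom ▷ A ≫ app φ = (α_ A (Aᘁ : C) A).hom ≫ A ◁ ε_ A (Aᘁ : C) ≫ (ρ_ A).hom := by
  simp [app]

theorem whiskerLeft_hom_act_B :
    A ◁ φ.hom ≫ act φ (reflexiveAlgebra φ).B ▷ A ≫ app φ =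
      (α_ A A (Aᘁ : C)).inv ≫ app φ ▷ (Aᘁ : C) ≫ φ.hom := by
  refine app_cancel φ ?_
  have h := rep_B (φ := φ)
  unfold Rep evTensor at h
  calc _ = 𝟙 _ ⊗≫ (A ◁ φ.hom ≫ act φ (reflexiveAlgebra φ).B ▷ A) ▷ A ⊗≫
        app φ ▷ A ≫ app φ := by monoidal
    _ = 𝟙 _ ⊗≫ A ◁ φ.hom ▷ A ⊗≫ (act φ (reflexiveAlgebra φ).B ▷ (A ⊗ A) ≫
        (α_ A A A).inv ≫ app φ ▷ A ≫ app φ) := by monoidal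
    _ = 𝟙 _ ⊗≫ A ◁ (φ.hom ▷ A ≫ app φ) ⊗≫ app φ := by
        rw [h]; monoidal
    _ = 𝟙 _ ⊗≫ ((A ⊗ A) ◁ ε_ A (Aᘁ : C) ≫ app φ ▷ 𝟙_ C) ⊗≫ 𝟙 _ := by
        rw [hom_whiskerRight_app]; monoidal
    _ = 𝟙 _ ⊗≫ app φ ▷ ((Aᘁ : C) ⊗ A) ⊗≫ (φ.hom ▷ A ≫ app φ) := by
        rw [hom_whiskerRight_app, whisker_exchange]; monoidal
    _ = _ := by monoidal

/-- Under A ≅ A ⊗ A*, the map B k acts on the factor A alone, whereas `lam` adds its new strands on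
the right. This is right tightening. -/
theorem whiskerLeft_lam_act_B :
    A ◁ lam φ ≫ act φ (reflexiveAlgebra φ).B ▷ (A ⊗ A) ≫ (α_ A A A).inv ≫ app φ ▷ A =
      app φ ≫ lam φ := by
  rw [lam_eq]
  calc _ = 𝟙 _ ⊗≫ A ◁ A ◁ twistCoev (η_ A (Aᘁ : C)) ⊗≫
        (A ◁ φ.hom ≫ act φ (reflexiveAlgebra φ).B ▷ A ≫ app φ) ▷ A := by
        monoidal
    _ = 𝟙 _ ⊗≫ ((A ⊗ A) ◁ twistCoev (η_ A (Aᘁ : C)) ≫ app φ ▷ ((Aᘁ : C) ⊗ A)) ⊗≫ φ.hom ▷ A := by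
        rw [whiskerLeft_hom_act_B]; monoidal
    _ = _ := by
        rw [whisker_exchange]; monoidal

theorem lam_braiding_app :
    lam φ ▷ A ≫ (α_ A A A).hom ≫ A ◁ (β_ A A).hom ≫ (α_ A A A).inv ≫ app φ ▷ A =
      A ◁ (twist A).hom := by
  rw [lam_eq]
  calc _ = 𝟙 _ ⊗≫ A ◁ twistCoev (η_ A (Aᘁ : C)) ▷ A ⊗≫
        (φ.hom ▷ (A ⊗ A) ≫ A ◁ (β_ A A).hom) ⊗≫ app φ ▷ A := by monoidal
    _ = 𝟙 _ ⊗≫ A ◁ twistCoev (η_ A (Aᘁ : C)) ▷ A ⊗≫ (A ⊗ (Aᘁ : C)) ◁ (β_ A A).hom ⊗≫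
        (φ.hom ▷ A ≫ app φ) ▷ A := by rw [← whisker_exchange]; monoidal
    _ = 𝟙 _ ⊗≫ A ◁ (twistCoev (η_ A (Aᘁ : C)) ▷ A ⊗≫ (Aᘁ : C) ◁ (β_ A A).hom ⊗≫
        ε_ A (Aᘁ : C) ▷ A) ⊗≫ 𝟙 _ := by rw [hom_whiskerRight_app]; monoidal
    _ = _ := by rw [zigzag_dual.yank_hom]; monoidal

theorem lam_braiding_inv_app :
    lam φ ▷ A ≫ (α_ A A A).hom ≫ A ◁ (β_ A A).inv ≫ (α_ A A A).inv ≫ app φ ▷ A =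
      A ◁ (twist A).inv := by
  rw [lam_eq]
  calc _ = 𝟙 _ ⊗≫ A ◁ twistCoev (η_ A (Aᘁ : C)) ▷ A ⊗≫
        (φ.hom ▷ (A ⊗ A) ≫ A ◁ (β_ A A).inv) ⊗≫ app φ ▷ A := by monoidal
    _ = 𝟙 _ ⊗≫ A ◁ twistCoev (η_ A (Aᘁ : C)) ▷ A ⊗≫ (A ⊗ (Aᘁ : C)) ◁ (β_ A A).inv ⊗≫
        (φ.hom ▷ A ≫ app φ) ▷ A := by rw [← whisker_exchange]; monoidal
    _ = 𝟙 _ ⊗≫ A ◁ (twistCoev (η_ A (Aᘁ : C)) ▷ A ⊗≫ (Aᘁ : C) ◁ (β_ A A).inv ⊗≫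
        ε_ A (Aᘁ : C) ▷ A) ⊗≫ 𝟙 _ := by rw [hom_whiskerRight_app]; monoidal
    _ = _ := by rw [zigzag_dual.yank_inv]; monoidal

theorem act_ap_traceComb (a : 𝟙_ C ⟶ A) :
    act φ ((reflexiveAlgebra φ).ap (traceComb φ) a) = lam φ ≫ act φ a ▷ A ≫ app φ := by
  have h := rep_traceComb (φ := φ)
  unfold Rep evTensor at h
  rw [act_eq_ap, h, act]
  calc _ = 𝟙 _ ⊗≫ (a ▷ A ≫ A ◁ lam φ) ⊗≫ app φ ▷ A ⊗≫ app φ := by monoidal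
    _ = _ := by rw [← whisker_exchange]; monoidal

/-- The iterated `φ`. -/
def foldTwo : A ⊗ ((Aᘁ : C) ⊗ (Aᘁ : C)) ⟶ A :=
  (α_ A (Aᘁ : C) (Aᘁ : C)).inv ≫ φ.hom ▷ (Aᘁ : C) ≫ φ.hom

theorem foldTwo_ev :
    foldTwo φ ▷ (A ⊗ A) ≫ evTensor (app φ) (app φ) =
      (α_ _ _ _).hom ≫ A ◁ nestEv (ε_ A (Aᘁ : C)) (ε_ A (Aᘁ : C)) ≫ (ρ_ A).hom := by
  unfold foldTwo evTensor nestEv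
  calc _ = 𝟙 _ ⊗≫ φ.hom ▷ (Aᘁ : C) ▷ A ▷ A ⊗≫ (φ.hom ▷ A ≫ app φ) ▷ A ⊗≫ app φ := by monoidal
    _ = 𝟙 _ ⊗≫ (φ.hom ▷ ((Aᘁ : C) ⊗ A) ≫ A ◁ ε_ A (Aᘁ : C)) ▷ A ⊗≫ app φ := by
        rw [hom_whiskerRight_app]; monoidal
    _ = 𝟙 _ ⊗≫ A ◁ (Aᘁ : C) ◁ ε_ A (Aᘁ : C) ▷ A ⊗≫ (φ.hom ▷ A ≫ app φ) := by
        rw [← whisker_exchange]; monoidal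
    _ = _ := by rw [hom_whiskerRight_app]; monoidal

/-- Evaluated on two arguments, C⁻ becomes the inverse braiding of A ⊗ A, whose mate is the inverse
braiding of A* ⊗ A*. -/
theorem foldTwo_act_C :
    foldTwo φ ≫ act φ ((reflexiveAlgebra φ).C false) =
      A ◁ (β_ (Aᘁ : C) (Aᘁ : C)).inv ≫ foldTwo φ := by
  refine (cancels_app φ).tensor (cancels_app φ) _ _ _ ?_
  have h := rep_C (φ := φ) false
  unfold Rep at h
  rw [comp_whiskerRight_assoc, h, ← whisker_exchange_assoc, foldTwo_ev,
    comp_whiskerRight_assoc, foldTwo_ev]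
  have hm := braiding_mate (ε_ A (Aᘁ : C))
  have hm' : (β_ (Aᘁ : C) (Aᘁ : C)).inv ▷ (A ⊗ A) ≫
      nestEv (ε_ A (Aᘁ : C)) (ε_ A (Aᘁ : C)) =
      ((Aᘁ : C) ⊗ (Aᘁ : C)) ◁ (β_ A A).inv ≫ nestEv (ε_ A (Aᘁ : C)) (ε_ A (Aᘁ : C)) := by
    rw [← cancel_epi ((β_ (Aᘁ : C) (Aᘁ : C)).hom ▷ (A ⊗ A)), hom_inv_whiskerRight_assoc,
      ← whisker_exchange_assoc, hm, whiskerLeft_inv_hom_assoc]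
  simp only [Bool.false_eq_true, if_false]
  calc _ = 𝟙 _ ⊗≫ A ◁ (((Aᘁ : C) ⊗ (Aᘁ : C)) ◁ (β_ A A).inv ≫
        nestEv (ε_ A (Aᘁ : C)) (ε_ A (Aᘁ : C))) ⊗≫ 𝟙 _ := by monoidal
    _ = _ := by rw [← hm']; monoidal

theorem lam_lam :
    lam φ ≫ lam φ ▷ A ≫ (α_ A A A).hom =
      (ρ_ A).inv ≫ A ◁ nestCoev (twistCoev (η_ A (Aᘁ : C))) (twistCoev (η_ A (Aᘁ : C))) ≫
        (α_ _ _ _).inv ≫ foldTwo φ ▷ (A ⊗ A) := by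
  rw [lam_eq]
  unfold nestCoev foldTwo
  calc _ = 𝟙 _ ⊗≫ A ◁ twistCoev (η_ A (Aᘁ : C)) ⊗≫
        (φ.hom ▷ 𝟙_ C ≫ A ◁ twistCoev (η_ A (Aᘁ : C))) ▷ A ⊗≫ φ.hom ▷ A ▷ A ⊗≫ 𝟙 _ := by monoidal
    _ = _ := by rw [← whisker_exchange]; monoidal

theorem lam_lam_exchange :
    lam φ ≫ lam φ ▷ A ≫ (α_ A A A).hom ≫ act φ ((reflexiveAlgebra φ).C false) ▷ (A ⊗ A) ≫
      A ◁ (β_ A A).hom = lam φ ≫ lam φ ▷ A ≫ (α_ A A A).hom := by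
  have h := (zigzag_dual (A := A)).twisted
  -- On the nested twisted units, braiding A ⊗ A equals braiding A* ⊗ A*, which cancels the inverse
  -- braiding coming from C⁻.
  have hN := (h.nest h).coev_of_ev (braiding_mate (twistEv (ε_ A (Aᘁ : C))))
  have hN' : nestCoev (twistCoev (η_ A (Aᘁ : C))) (twistCoev (η_ A (Aᘁ : C))) ≫
      (β_ (Aᘁ : C) (Aᘁ : C)).inv ▷ (A ⊗ A) ≫ ((Aᘁ : C) ⊗ (Aᘁ : C)) ◁ (β_ A A).hom =
      nestCoev (twistCoev (η_ A (Aᘁ : C))) (twistCoev (η_ A (Aᘁ : C))) := by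
    rw [← whisker_exchange, ← reassoc_of% hN, hom_inv_whiskerRight, Category.comp_id]
  rw [reassoc_of% (lam_lam φ), lam_lam]
  calc _ = 𝟙 _ ⊗≫ A ◁ nestCoev (twistCoev (η_ A (Aᘁ : C))) (twistCoev (η_ A (Aᘁ : C))) ⊗≫
        (foldTwo φ ≫ act φ ((reflexiveAlgebra φ).C false)) ▷ (A ⊗ A) ≫ A ◁ (β_ A A).hom := by
        monoidal
    _ = 𝟙 _ ⊗≫ A ◁ nestCoev (twistCoev (η_ A (Aᘁ : C))) (twistCoev (η_ A (Aᘁ : C))) ⊗≫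
        A ◁ (β_ (Aᘁ : C) (Aᘁ : C)).inv ▷ (A ⊗ A) ⊗≫
        (foldTwo φ ▷ (A ⊗ A) ≫ A ◁ (β_ A A).hom) := by
        rw [foldTwo_act_C]; monoidal
    _ = 𝟙 _ ⊗≫ A ◁ (nestCoev (twistCoev (η_ A (Aᘁ : C))) (twistCoev (η_ A (Aᘁ : C))) ≫
        (β_ (Aᘁ : C) (Aᘁ : C)).inv ▷ (A ⊗ A) ≫ ((Aᘁ : C) ⊗ (Aᘁ : C)) ◁ (β_ A A).hom) ⊗≫
        foldTwo φ ▷ (A ⊗ A) := by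
        rw [← whisker_exchange]; monoidal
    _ = _ := by rw [hN']; monoidal

theorem comp_I (a : 𝟙_ C ⟶ A) :
    (reflexiveAlgebra φ).comp a (reflexiveAlgebra φ).I = a :=
  act_injective φ (by rw [act_comp, act_I, Category.id_comp])

theorem I_comp (a : 𝟙_ C ⟶ A) :
    (reflexiveAlgebra φ).comp (reflexiveAlgebra φ).I a = a :=
  act_injective φ (by rw [act_comp, act_I, Category.comp_id])

theorem pow_one (a : 𝟙_ C ⟶ A) : (reflexiveAlgebra φ).pow a 1 = a := comp_I φ a

theorem pow_two (a : 𝟙_ C ⟶ A) :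
    (reflexiveAlgebra φ).pow a 2 = (reflexiveAlgebra φ).comp a a := by
  change (reflexiveAlgebra φ).comp a ((reflexiveAlgebra φ).pow a 1) = _
  rw [pow_one]

theorem isTraced : (reflexiveAlgebra φ).IsTraced (traceComb φ) where
  toIsBalanced := isBalanced
  left_tightening t := by
    have c1 := cancels_app φ
    rw [pow_two]
    exact (((rep_CB t _).whiskerRight (app φ)).comp rep_B).eq
      (rep_traceComb.lift.comp ((rep_B.whiskerRight (app φ)).comp rep_B).assoc_left)
      (c1.tensor c1) rep_traceComb
  right_tightening t := by
    have c1 := cancels_app φ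
    exact (rep_traceComb.lift.comp (((rep_CB t _).whiskerRight
      (evTensor (app φ) (app φ))).comp (rep_B.whiskerRight (app φ)).assoc_left)).eq
      (rep_B.comp rep_traceComb) (c1.tensor c1) (whiskerLeft_lam_act_B φ)
  yanking s := by
    refine act_injective φ (app_cancel φ ?_)
    have h := rep_theta (φ := φ) s
    have h2 := rep_C (φ := φ) s
    unfold Rep at h h2
    unfold evTensor at h2
    rw [h, act_ap_traceComb]
    calc _ = 𝟙 _ ⊗≫ lam φ ▷ A ⊗≫ (act φ ((reflexiveAlgebra φ).C s) ▷ (A ⊗ A) ≫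
          (α_ A A A).inv ≫ app φ ▷ A ≫ app φ) := by monoidal
      _ = (lam φ ▷ A ≫ (α_ A A A).hom ≫ A ◁ (if s then (β_ A A).hom else (β_ A A).inv) ≫
          (α_ A A A).inv ≫ app φ ▷ A) ≫ app φ := by rw [h2]; monoidal
      _ = _ := by
        cases s
        · exact congrArg (· ≫ app φ) (lam_braiding_inv_app φ)
        · exact congrArg (· ≫ app φ) (lam_braiding_app φ)
  exchange t := by
    have c1 := cancels_app φ
    rw [pow_two]
    have hT := (rep_traceComb (φ := φ).comp
      (rep_traceComb (φ := φ).whiskerRight (app φ))).assoc_right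
    exact (hT.comp (((rep_CB t _).whiskerRight (evTensor (app φ) (app φ))).comp
      (rep_C true).lift)).eq hT c1 (by simpa using lam_lam_exchange φ)

end Traced

/-! ### F is strict monoidal -/

section Functor

variable {C : Type u} [Category.{v} C] [MonoidalCategory C] [BraidedCategory C]
  [BalancedCategory C] [RightRigidCategory C]
variable {A : C} {φ : A ⊗ (Aᘁ : C) ≅ A}

theorem appN_add (l m : ℕ) :
    A ◁ (tpowAdd A l m).hom ≫ appN φ (l + m) = evTensor (appN φ m) (appN φ l) := by
  induction m with
  | zero =>
    change A ◁ (λ_ (tpow A l)).hom ≫ appN φ l =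
      (α_ A (𝟙_ C) (tpow A l)).inv ≫ (ρ_ A).hom ▷ tpow A l ≫ appN φ l
    monoidal
  | succ m ih =>
    change A ◁ ((α_ A (tpow A m) (tpow A l)).hom ≫ A ◁ (tpowAdd A l m).hom) ≫
        (α_ A A (tpow A (l + m))).inv ≫ app φ ▷ tpow A (l + m) ≫ appN φ (l + m) =
      (α_ A (A ⊗ tpow A m) (tpow A l)).inv ≫
        ((α_ A A (tpow A m)).inv ≫ app φ ▷ tpow A m ≫ appN φ m) ▷ tpow A l ≫ appN φ l
    calc _ = 𝟙 _ ⊗≫ ((A ⊗ A) ◁ (tpowAdd A l m).hom ≫ app φ ▷ tpow A (l + m)) ≫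
          appN φ (l + m) := by monoidal
      _ = 𝟙 _ ⊗≫ app φ ▷ (tpow A m ⊗ tpow A l) ≫ (A ◁ (tpowAdd A l m).hom ≫
          appN φ (l + m)) := by rw [whisker_exchange]; monoidal
      _ = _ := by rw [ih, evTensor]; monoidal

theorem appN_add_inv (l m : ℕ) :
    appN φ (l + m) = A ◁ (tpowAdd A l m).inv ≫ evTensor (appN φ m) (appN φ l) := by
  rw [← appN_add, whiskerLeft_inv_hom_assoc]

theorem Rep.assoc_symm {X Y Z X' Y' Z' : C} {p : A ⊗ X ⟶ A} {q : A ⊗ Y ⟶ A} {r : A ⊗ Z ⟶ A}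
    {p' : A ⊗ X' ⟶ A} {q' : A ⊗ Y' ⟶ A} {r' : A ⊗ Z' ⟶ A}
    {f : X ⊗ (Y ⊗ Z) ⟶ X' ⊗ (Y' ⊗ Z')} {a : 𝟙_ C ⟶ A}
    (ha : Rep φ (evTensor p (evTensor q r)) (evTensor p' (evTensor q' r')) f a) :
    Rep φ (evTensor (evTensor p q) r) (evTensor (evTensor p' q') r')
      ((α_ X Y Z).hom ≫ f ≫ (α_ X' Y' Z').inv) a := by
  unfold Rep evTensor at *
  calc _ = A ◁ (α_ X Y Z).hom ≫ (act φ a ▷ (X ⊗ (Y ⊗ Z)) ≫ (α_ A X (Y ⊗ Z)).inv ≫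
        p ▷ (Y ⊗ Z) ≫ (α_ A Y Z).inv ≫ q ▷ Z ≫ r) := by monoidal
    _ = _ := by rw [ha]; monoidal

variable [RibbonCategory C]

theorem Rep.shift {X Y : C} {p : A ⊗ X ⟶ A} {q : A ⊗ Y ⟶ A} {f : X ⟶ Y} {a : 𝟙_ C ⟶ A}
    (ha : Rep φ p q f a) (n : ℕ) :
    Rep φ (evTensor (appN φ n) p) (evTensor (appN φ n) q) (tpow A n ◁ f)
      ((reflexiveAlgebra φ).shift n a) := by
  induction n with
  | zero =>
    unfold Rep evTensor at *
    change act φ a ▷ (𝟙_ C ⊗ X) ≫ (α_ A (𝟙_ C) X).inv ≫ (ρ_ A).hom ▷ X ≫ p =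
      A ◁ 𝟙_ C ◁ f ≫ (α_ A (𝟙_ C) Y).inv ≫ (ρ_ A).hom ▷ Y ≫ q
    calc _ = 𝟙 _ ⊗≫ (act φ a ▷ X ≫ p) := by monoidal
      _ = _ := by rw [ha]; monoidal
  | succ n ih =>
    have h := ih.lift.assoc_symm
    have e : (α_ A (tpow A n) X).hom ≫ A ◁ tpow A n ◁ f ≫ (α_ A (tpow A n) Y).inv =
        (A ⊗ tpow A n) ◁ f := by monoidal
    rw [e] at h
    exact h

theorem F_id (m : ℕ) : F φ (𝟙 (tpow A m)) = (reflexiveAlgebra φ).I :=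
  (rep_F _).eq (rep_I _) (cancels_appN φ m) rfl

theorem F_comp {l m n : ℕ} (f : tpow A l ⟶ tpow A m) (g : tpow A m ⟶ tpow A n) :
    F φ (f ≫ g) = (reflexiveAlgebra φ).comp (F φ f) (F φ g) :=
  (rep_F _).eq ((rep_F f).comp (rep_F g)) (cancels_appN φ l) rfl

theorem F_tensor {m n m' n' : ℕ} (f : tpow A m ⟶ tpow A n) (g : tpow A m' ⟶ tpow A n') :
    F φ ((tpowAdd A m' m).inv ≫ (f ⊗ₘ g) ≫ (tpowAdd A n' n).hom) =
      (reflexiveAlgebra φ).tensor n (F φ f) (F φ g) :=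
  (rep_F_conj (tpowAdd A m' m).symm (tpowAdd A n' n).symm (appN_add_inv _ _)
    (appN_add_inv _ _) (f ⊗ₘ g)).eq
    (((rep_F f).whiskerRight (appN φ m')).comp ((rep_F g).shift n))
    ((cancels_appN φ m).tensor (cancels_appN φ m')) (MonoidalCategory.tensorHom_def f g)

end Functor

/-! ### The arity equation and the interchange law -/

section Arity

variable {C : Type u} [Category.{v} C] [MonoidalCategory C] [BraidedCategory C]
  [BalancedCategory C] [RightRigidCategory C] [RibbonCategory C]
variable {A : C} (φ : A ⊗ (Aᘁ : C) ≅ A)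

/-- The map `(k, x) ↦ Bⁿ k x`. -/
def powB (n : ℕ) : A ⊗ A ⟶ A :=
  act φ ((reflexiveAlgebra φ).pow (reflexiveAlgebra φ).B n) ▷ A ≫ app φ

theorem powB_zero : powB φ 0 = app φ := by
  change act φ (reflexiveAlgebra φ).I ▷ A ≫ app φ = _
  rw [act_I, id_whiskerRight, Category.id_comp]

theorem act_pow_succ (a : 𝟙_ C ⟶ A) (n : ℕ) :
    act φ ((reflexiveAlgebra φ).pow a (n + 1)) =
      act φ ((reflexiveAlgebra φ).pow a n) ≫ act φ a :=
  act_comp _ _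

/-- Powers are defined by adding a factor on one side; the recursions for Bⁿ need both sides. -/
theorem act_pow_succ' (a : 𝟙_ C ⟶ A) (n : ℕ) :
    act φ ((reflexiveAlgebra φ).pow a (n + 1)) =
      act φ a ≫ act φ ((reflexiveAlgebra φ).pow a n) := by
  induction n with
  | zero =>
    rw [pow_one]
    change _ = act φ a ≫ act φ (reflexiveAlgebra φ).I
    rw [act_I, Category.comp_id]
  | succ n ih => rw [act_pow_succ, ih, Category.assoc, ← act_pow_succ, ih]

theorem powB_succ (n : ℕ) : powB φ (n + 1) = act φ (reflexiveAlgebra φ).B ▷ A ≫ powB φ n := by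
  rw [powB, act_pow_succ', comp_whiskerRight_assoc, powB]

theorem powB_succ_app (n : ℕ) :
    powB φ (n + 1) ▷ A ≫ app φ = (α_ A A A).hom ≫ A ◁ app φ ≫ powB φ n := by
  have h := rep_B (φ := φ)
  unfold Rep evTensor at h
  rw [powB, act_pow_succ, powB, whisker_exchange_assoc, ← h]
  monoidal

/-- The rule Bⁿ k x y₁ … yₙ = k (x y₁ … yₙ). -/
theorem powB_appN (n : ℕ) :
    powB φ n ▷ tpow A n ≫ appN φ n = (α_ A A (tpow A n)).hom ≫ A ◁ appN φ n ≫ app φ := by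
  induction n with
  | zero =>
    change powB φ 0 ▷ 𝟙_ C ≫ (ρ_ A).hom = (α_ A A (𝟙_ C)).hom ≫ A ◁ (ρ_ A).hom ≫ app φ
    rw [powB_zero]
    monoidal
  | succ n ih =>
    change powB φ (n + 1) ▷ (A ⊗ tpow A n) ≫ (α_ A A (tpow A n)).inv ≫ app φ ▷ tpow A n ≫
      appN φ n = (α_ A A (A ⊗ tpow A n)).hom ≫
        A ◁ ((α_ A A (tpow A n)).inv ≫ app φ ▷ tpow A n ≫ appN φ n) ≫ app φ
    calc _ = 𝟙 _ ⊗≫ (powB φ (n + 1) ▷ A ≫ app φ) ▷ tpow A n ≫ appN φ n := by monoidal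
      _ = 𝟙 _ ⊗≫ A ◁ app φ ▷ tpow A n ⊗≫ (powB φ n ▷ tpow A n ≫ appN φ n) := by
        rw [powB_succ_app]; monoidal
      _ = _ := by rw [ih]; monoidal

theorem act_bullet (a : 𝟙_ C ⟶ A) :
    act φ ((reflexiveAlgebra φ).bullet a) = (ρ_ A).inv ≫ A ◁ a ≫ app φ := by
  unfold BalancedData.bullet
  rw [act_ap_ap_C, act_I, id_whiskerRight, Category.id_comp]

variable {φ}

/-- Applied to k and x, the defining equation becomes Bᵐ k (a x) = a (Bⁿ k x), and nothing is lost
because currying is injective. -/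
theorem arity_iff {m n : ℕ} {a : 𝟙_ C ⟶ A} :
    (reflexiveAlgebra φ).Arity m n a ↔ A ◁ act φ a ≫ powB φ m = powB φ n ≫ act φ a := by
  have e : (act φ ((reflexiveAlgebra φ).comp ((reflexiveAlgebra φ).bullet a)
      ((reflexiveAlgebra φ).pow (reflexiveAlgebra φ).B (m + 1)))) ▷ A ≫ app φ =
      A ◁ act φ a ≫ powB φ m := by
    have h := rep_CB (φ := φ) true a
    unfold Rep at h
    rw [act_ap_ap_C] at h
    rw [act_comp, act_pow_succ, act_bullet, powB, whisker_exchange_assoc, ← h]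
    have : act φ (reflexiveAlgebra φ).B ≫ (ρ_ A).inv ≫ A ◁ a =
        (ρ_ A).inv ≫ A ◁ a ≫ act φ (reflexiveAlgebra φ).B ▷ A := by
      rw [rightUnitor_inv_naturality_assoc, whisker_exchange]
    rw [← reassoc_of% this]
    simp
  have e' : (act φ ((reflexiveAlgebra φ).comp ((reflexiveAlgebra φ).ap (reflexiveAlgebra φ).B a)
      ((reflexiveAlgebra φ).pow (reflexiveAlgebra φ).B n))) ▷ A ≫ app φ =
      powB φ n ≫ act φ a := by
    rw [act_comp, comp_whiskerRight_assoc, act_ap_B, powB, Category.assoc]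
  rw [← e, ← e']
  exact ⟨fun h => by rw [h], fun h => act_injective φ (app_cancel φ h)⟩

/-- On m further arguments y, both sides of the arity equation give k (x (f y)). -/
theorem Rep.arity {m n : ℕ} {f : tpow A m ⟶ tpow A n} {a : 𝟙_ C ⟶ A}
    (h : Rep φ (appN φ m) (appN φ n) f a) : (reflexiveAlgebra φ).Arity m n a := by
  rw [arity_iff]
  refine appN_cancel φ m ?_
  unfold Rep at h
  symm
  calc _ = powB φ n ▷ tpow A m ≫ (act φ a ▷ tpow A m ≫ appN φ m) := by monoidal
    _ = (A ⊗ A) ◁ f ≫ (powB φ n ▷ tpow A n ≫ appN φ n) := by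
        rw [h, whisker_exchange_assoc]
    _ = 𝟙 _ ⊗≫ A ◁ (A ◁ f ≫ appN φ n) ⊗≫ app φ := by
        rw [powB_appN]; monoidal
    _ = 𝟙 _ ⊗≫ (A ◁ act φ a) ▷ tpow A m ⊗≫ ((α_ A A (tpow A m)).hom ≫
        A ◁ appN φ m ≫ app φ) := by
        rw [← h]; monoidal
    _ = _ := by rw [← powB_appN]; monoidal

theorem arity_F {m n : ℕ} (f : tpow A m ⟶ tpow A n) :
    (reflexiveAlgebra φ).Arity m n (F φ f) :=
  (rep_F f).arity

theorem arity_comp {l m n : ℕ} {a b : 𝟙_ C ⟶ A} (ha : (reflexiveAlgebra φ).Arity l m a)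
    (hb : (reflexiveAlgebra φ).Arity m n b) :
    (reflexiveAlgebra φ).Arity l n ((reflexiveAlgebra φ).comp a b) := by
  rw [arity_iff] at *
  rw [act_comp, whiskerLeft_comp_assoc, ha, reassoc_of% hb]

theorem arity_succ {m n : ℕ} {a : 𝟙_ C ⟶ A} (ha : (reflexiveAlgebra φ).Arity m n a) :
    (reflexiveAlgebra φ).Arity (m + 1) (n + 1) a := by
  rw [arity_iff] at *
  rw [powB_succ, powB_succ, whisker_exchange_assoc, ha, Category.assoc]

theorem arity_add {m n : ℕ} {a : 𝟙_ C ⟶ A} (ha : (reflexiveAlgebra φ).Arity m n a) (k : ℕ) :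
    (reflexiveAlgebra φ).Arity (m + k) (n + k) a := by
  induction k with
  | zero => exact ha
  | succ k ih => exact arity_succ ih

theorem arity_ap_B {m n : ℕ} {a : 𝟙_ C ⟶ A} (ha : (reflexiveAlgebra φ).Arity m n a) :
    (reflexiveAlgebra φ).Arity (m + 1) (n + 1)
      ((reflexiveAlgebra φ).ap (reflexiveAlgebra φ).B a) := by
  rw [arity_iff] at *
  refine app_cancel φ ?_
  calc _ = 𝟙 _ ⊗≫ A ◁ act φ ((reflexiveAlgebra φ).ap (reflexiveAlgebra φ).B a) ▷ A ⊗≫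
        (powB φ (m + 1) ▷ A ≫ app φ) := by monoidal
    _ = 𝟙 _ ⊗≫ A ◁ (act φ ((reflexiveAlgebra φ).ap (reflexiveAlgebra φ).B a) ▷ A ≫ app φ) ≫
        powB φ m := by rw [powB_succ_app]; monoidal
    _ = 𝟙 _ ⊗≫ A ◁ app φ ≫ (A ◁ act φ a ≫ powB φ m) := by rw [act_ap_B]; monoidal
    _ = ((α_ A A A).hom ≫ A ◁ app φ ≫ powB φ n) ≫ act φ a := by rw [ha]; monoidal
    _ = powB φ (n + 1) ▷ A ≫
        (act φ ((reflexiveAlgebra φ).ap (reflexiveAlgebra φ).B a) ▷ A ≫ app φ) := by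
        rw [← powB_succ_app, act_ap_B, Category.assoc]
    _ = _ := by monoidal

theorem comp_assoc (a b c : 𝟙_ C ⟶ A) :
    (reflexiveAlgebra φ).comp ((reflexiveAlgebra φ).comp a b) c =
      (reflexiveAlgebra φ).comp a ((reflexiveAlgebra φ).comp b c) :=
  act_injective φ (by simp only [act_comp, Category.assoc])

theorem ap_B_comp (a b : 𝟙_ C ⟶ A) :
    (reflexiveAlgebra φ).ap (reflexiveAlgebra φ).B ((reflexiveAlgebra φ).comp a b) =
      (reflexiveAlgebra φ).comp ((reflexiveAlgebra φ).ap (reflexiveAlgebra φ).B a)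
        ((reflexiveAlgebra φ).ap (reflexiveAlgebra φ).B b) := by
  refine act_injective φ (app_cancel φ ?_)
  simp only [act_comp, act_ap_B, comp_whiskerRight_assoc, reassoc_of% act_ap_B]

theorem ap_pow_B (n : ℕ) (a : 𝟙_ C ⟶ A) :
    (reflexiveAlgebra φ).ap ((reflexiveAlgebra φ).pow (reflexiveAlgebra φ).B n) a =
      (reflexiveAlgebra φ).shift n a := by
  induction n with
  | zero => exact isExtensional.ax_I a
  | succ n ih => exact (isExtensional.ax_B _ _ _).trans (by rw [ih]; rfl)

theorem act_shift (n : ℕ) (a : 𝟙_ C ⟶ A) :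
    act φ ((reflexiveAlgebra φ).shift n a) = (λ_ A).inv ≫ a ▷ A ≫ powB φ n := by
  rw [← ap_pow_B, act_eq_ap, powB]

/-- The interchange law of the internal PRO. -/
theorem comp_shift {m n : ℕ} {a : 𝟙_ C ⟶ A} (ha : (reflexiveAlgebra φ).Arity m n a)
    (b : 𝟙_ C ⟶ A) :
    (reflexiveAlgebra φ).comp a ((reflexiveAlgebra φ).shift n b) =
      (reflexiveAlgebra φ).comp ((reflexiveAlgebra φ).shift m b) a := by
  refine act_injective φ ?_
  -- The law is the arity equation with k = b.
  rw [arity_iff] at ha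
  rw [act_comp, act_comp, act_shift, act_shift, Category.assoc, Category.assoc, ← ha,
    ← whisker_exchange_assoc, leftUnitor_inv_naturality_assoc]

end Arity

/-! ### The self-duality α, β and the left trace -/

section Duality

variable {C : Type u} [Category.{v} C] [MonoidalCategory C] [BraidedCategory C]
  [BalancedCategory C] [RightRigidCategory C] [RibbonCategory C]
variable {A : C} (φ : A ⊗ (Aᘁ : C) ≅ A)

/-- The η-rule: currying the evaluation of x gives back x. -/
theorem hom_coev_app :
    (ρ_ A).inv ≫ A ◁ η_ A (Aᘁ : C) ≫ (α_ A A (Aᘁ : C)).inv ≫ app φ ▷ (Aᘁ : C) ≫ φ.hom = 𝟙 A := by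
  rw [app_eq]
  calc _ = 𝟙 _ ⊗≫ (A ◁ η_ A (Aᘁ : C) ≫ φ.inv ▷ (A ⊗ (Aᘁ : C))) ⊗≫
        A ◁ ε_ A (Aᘁ : C) ▷ (Aᘁ : C) ⊗≫ φ.hom := by monoidal
    _ = φ.inv ⊗≫ A ◁ ((Aᘁ : C) ◁ η_ A (Aᘁ : C) ⊗≫ ε_ A (Aᘁ : C) ▷ (Aᘁ : C)) ⊗≫ φ.hom := by
        rw [whisker_exchange]; monoidal
    _ = φ.inv ≫ φ.hom := by
        rw [(zigzag_dual (A := A)).coev_ev']; monoidal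
    _ = _ := φ.inv_hom_id

/-- The map `f` is recovered by currying the new argument, uncrossing the strands and applying the
η-rule. -/
theorem braiding_app_cancel {W : C} {f g : W ⟶ A ⊗ A}
    (h : f ▷ A ≫ (α_ A A A).hom ≫ A ◁ (β_ A A).hom ≫ (α_ A A A).inv ≫ app φ ▷ A =
      g ▷ A ≫ (α_ A A A).hom ≫ A ◁ (β_ A A).hom ≫ (α_ A A A).inv ≫ app φ ▷ A) : f = g := by
  have key : ∀ f : W ⟶ A ⊗ A, f = 𝟙 _ ⊗≫ W ◁ η_ A (Aᘁ : C) ⊗≫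
      (f ▷ A ≫ (α_ A A A).hom ≫ A ◁ (β_ A A).hom ≫ (α_ A A A).inv ≫ app φ ▷ A) ▷ (Aᘁ : C) ⊗≫
      A ◁ (β_ A (Aᘁ : C)).hom ⊗≫ φ.hom ▷ A := by
    intro f
    symm
    calc _ = 𝟙 _ ⊗≫ (W ◁ η_ A (Aᘁ : C) ≫ f ▷ (A ⊗ (Aᘁ : C))) ⊗≫
          A ◁ (β_ A A).hom ▷ (Aᘁ : C) ⊗≫ (app φ ▷ (A ⊗ (Aᘁ : C)) ≫
            A ◁ (β_ A (Aᘁ : C)).hom) ⊗≫ φ.hom ▷ A := by monoidal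
      _ = f ⊗≫ A ◁ (A ◁ η_ A (Aᘁ : C) ⊗≫ (β_ A A).hom ▷ (Aᘁ : C)) ⊗≫
          (A ⊗ A) ◁ (β_ A (Aᘁ : C)).hom ⊗≫ (app φ ▷ (Aᘁ : C) ≫ φ.hom) ▷ A := by
          rw [whisker_exchange f (η_ A (Aᘁ : C)),
            ← whisker_exchange (app φ) (β_ A (Aᘁ : C)).hom]
          monoidal
      _ = f ⊗≫ A ◁ η_ A (Aᘁ : C) ▷ A ⊗≫
          (A ⊗ A) ◁ ((β_ A (Aᘁ : C)).inv ≫ (β_ A (Aᘁ : C)).hom) ⊗≫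
          (app φ ▷ (Aᘁ : C) ≫ φ.hom) ▷ A := by
          rw [whiskerRight_braiding_coev]; monoidal
      _ = f ≫ ((ρ_ A).inv ≫ A ◁ η_ A (Aᘁ : C) ≫ (α_ A A (Aᘁ : C)).inv ≫ app φ ▷ (Aᘁ : C) ≫
          φ.hom) ▷ A := by
          rw [Iso.inv_hom_id]; monoidal
      _ = f := by rw [hom_coev_app, id_whiskerRight, Category.comp_id]
  rw [key f, key g, h]

/-- In both forms, crossing with a new argument and applying yanks to the twist: for `lam` by the
duality of A and A*, for the right side by the self-duality, whose unit is its own twist. -/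
theorem lam_eq_dualUnit :
    lam φ = (ρ_ A).inv ≫ A ◁ dualUnit φ ≫ (α_ A A A).inv ≫
      (act φ (betaComb φ) ▷ A ≫ app φ) ▷ A := by
  refine braiding_app_cancel φ ?_
  rw [lam_braiding_app]
  have hb := rep_betaComb (φ := φ)
  unfold Rep evTensor at hb
  symm
  calc _ = 𝟙 _ ⊗≫ A ◁ dualUnit φ ▷ A ⊗≫ ((act φ (betaComb φ) ▷ A ≫ app φ) ▷ (A ⊗ A) ≫
        A ◁ (β_ A A).hom) ⊗≫ app φ ▷ A := by monoidal
    _ = 𝟙 _ ⊗≫ A ◁ dualUnit φ ▷ A ⊗≫ A ◁ A ◁ (β_ A A).hom ⊗≫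
        (act φ (betaComb φ) ▷ (A ⊗ A) ≫ (α_ A A A).inv ≫ app φ ▷ A ≫ app φ) ▷ A := by
        rw [← whisker_exchange]; monoidal
    _ = 𝟙 _ ⊗≫ A ◁ (twistCoev (dualUnit φ) ▷ A ⊗≫ A ◁ (β_ A A).hom ⊗≫
        dualCounit φ ▷ A) ⊗≫ 𝟙 _ := by
        rw [hb, twistCoev_dualUnit]; monoidal
    _ = _ := by rw [(zigzag_dualUnit φ).yank_hom]; monoidal

/-- Both sides send k to a (β k α') α''. No arity is needed. -/
theorem ap_traceComb_eq (a : 𝟙_ C ⟶ A) :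
    (reflexiveAlgebra φ).ap (traceComb φ) a =
      (reflexiveAlgebra φ).comp (alphaComb φ) ((reflexiveAlgebra φ).comp
        ((reflexiveAlgebra φ).ap (reflexiveAlgebra φ).B a) (betaComb φ)) := by
  refine act_injective φ ?_
  have ha := rep_alphaComb (φ := φ)
  unfold Rep evTensor at ha
  rw [act_ap_traceComb, act_comp, act_comp, lam_eq_dualUnit]
  symm
  calc _ = (act φ (betaComb φ) ≫ act φ ((reflexiveAlgebra φ).ap (reflexiveAlgebra φ).B a)) ≫
        (ρ_ A).inv ≫ (act φ (alphaComb φ) ▷ 𝟙_ C ≫ (ρ_ A).hom) := by simp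
    _ = 𝟙 _ ⊗≫ ((act φ (betaComb φ) ≫
          act φ ((reflexiveAlgebra φ).ap (reflexiveAlgebra φ).B a)) ▷ 𝟙_ C ≫
        A ◁ dualUnit φ) ⊗≫ app φ ▷ A ⊗≫ app φ := by rw [ha]; monoidal
    _ = 𝟙 _ ⊗≫ A ◁ dualUnit φ ⊗≫ (act φ (betaComb φ) ▷ A ≫
          (act φ ((reflexiveAlgebra φ).ap (reflexiveAlgebra φ).B a) ▷ A ≫ app φ)) ▷ A ⊗≫
          app φ := by
        rw [← whisker_exchange]; monoidal
    _ = _ := by rw [act_ap_B]; monoidal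

theorem arity_alphaComb : (reflexiveAlgebra φ).Arity 0 2 (alphaComb φ) := arity_F _

theorem arity_betaComb : (reflexiveAlgebra φ).Arity 2 0 (betaComb φ) := arity_F _

theorem arity_C (s : Bool) : (reflexiveAlgebra φ).Arity 2 2 ((reflexiveAlgebra φ).C s) :=
  arity_F _

theorem arity_theta (s : Bool) : (reflexiveAlgebra φ).Arity 1 1 ((reflexiveAlgebra φ).θ s) :=
  arity_F _

theorem arity_ap_traceComb {m n : ℕ} {a : 𝟙_ C ⟶ A}
    (ha : (reflexiveAlgebra φ).Arity (m + 1) (n + 1) a) :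
    (reflexiveAlgebra φ).Arity m n ((reflexiveAlgebra φ).ap (traceComb φ) a) := by
  rw [ap_traceComb_eq]
  have h1 := arity_add (arity_alphaComb φ) m
  have h2 := arity_add (arity_betaComb φ) n
  rw [Nat.zero_add, Nat.add_comm] at h1 h2
  exact arity_comp h1 (arity_comp (arity_ap_B ha) h2)

theorem isRibbon : (reflexiveAlgebra φ).IsRibbon (alphaComb φ) (betaComb φ) where
  toIsBalanced := isBalanced
  arity_alpha := by
    have h := arity_alphaComb φ
    unfold BalancedData.Arity at h
    rwa [Nat.zero_add, pow_one] at h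
  arity_beta := by
    have h := arity_betaComb φ
    unfold BalancedData.Arity at h
    exact h.trans (comp_I φ _)
  duality1 := by
    have c1 := cancels_app φ
    rw [ap_B_I]
    refine ((rep_alphaComb.whiskerRight (app φ)).unit_left.assoc_right.comp
      rep_betaComb.lift.right_unit').eq (rep_I _) c1 ?_
    have h := (zigzag_dualUnit φ).ev_coev
    simp [reassoc_of% h]
  duality2 := by
    have c1 := cancels_app φ
    rw [ap_B_I]
    refine (rep_alphaComb.lift.left_unit'.comp
      (rep_betaComb.whiskerRight (app φ)).assoc_left.right_unit).eq (rep_I _) c1 ?_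
    have h := (zigzag_dualUnit φ).coev_ev
    simp [reassoc_of% h]
  duality_theta s := by
    have c1 := cancels_app φ
    refine (rep_alphaComb.comp ((rep_theta s).whiskerRight (app φ))).eq
      (rep_alphaComb.comp (rep_theta s).lift) cancels_unit ?_
    cases s
    · exact (zigzag_dualUnit φ).coev_twist_inv
    · exact (zigzag_dualUnit φ).coev_twist

theorem C_comp_C (s : Bool) :
    (reflexiveAlgebra φ).comp ((reflexiveAlgebra φ).C s) ((reflexiveAlgebra φ).C (!s)) =
      (reflexiveAlgebra φ).I := by
  rw [isExtensional.ax_cox1, ap_B_I, ap_B_I]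

theorem sigmaOne_one : (reflexiveAlgebra φ).sigmaOne 1 = (reflexiveAlgebra φ).C true := by
  change (reflexiveAlgebra φ).comp ((reflexiveAlgebra φ).ap (reflexiveAlgebra φ).B
    (reflexiveAlgebra φ).I) ((reflexiveAlgebra φ).C true) = _
  rw [ap_B_I, I_comp]

theorem sigmaOneInv_one : (reflexiveAlgebra φ).sigmaOneInv 1 = (reflexiveAlgebra φ).C false := by
  change (reflexiveAlgebra φ).comp ((reflexiveAlgebra φ).C false)
    ((reflexiveAlgebra φ).ap (reflexiveAlgebra φ).B (reflexiveAlgebra φ).I) = _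
  rw [ap_B_I, comp_I]

theorem sigma_succ (n : ℕ) : (reflexiveAlgebra φ).sigma 1 (n + 1) =
    (reflexiveAlgebra φ).comp ((reflexiveAlgebra φ).C true)
      ((reflexiveAlgebra φ).ap (reflexiveAlgebra φ).B ((reflexiveAlgebra φ).sigma 1 n)) := by
  rw [← sigmaOne_one]; rfl

theorem sigmaInv_succ (n : ℕ) : (reflexiveAlgebra φ).sigmaInv 1 (n + 1) =
    (reflexiveAlgebra φ).comp
      ((reflexiveAlgebra φ).ap (reflexiveAlgebra φ).B ((reflexiveAlgebra φ).sigmaInv 1 n))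
      ((reflexiveAlgebra φ).C false) := by
  rw [← sigmaOneInv_one]; rfl

theorem sigma_comp_sigmaInv (n : ℕ) :
    (reflexiveAlgebra φ).comp ((reflexiveAlgebra φ).sigma 1 n)
      ((reflexiveAlgebra φ).sigmaInv 1 n) = (reflexiveAlgebra φ).I := by
  induction n with
  | zero => exact I_comp φ _
  | succ n ih =>
    rw [sigma_succ, sigmaInv_succ, comp_assoc, ← comp_assoc _ _ ((reflexiveAlgebra φ).C false),
      ← ap_B_comp, ih, ap_B_I, I_comp]
    exact C_comp_C φ true

/-- A closed form for the braid: with c x y = y x up to the crossing, σ_{1,n} k x = Bⁿ (c x) k. This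
puts it in the shape of the arity equation. -/
theorem act_sigma {c : A ⟶ A} (hc : c ▷ A ≫ app φ = (β_ A A).hom ≫ app φ) (n : ℕ) :
    act φ ((reflexiveAlgebra φ).sigma 1 n) ▷ A ≫ app φ =
      (β_ A A).inv ≫ c ▷ A ≫ powB φ n := by
  induction n with
  | zero =>
    change act φ (reflexiveAlgebra φ).I ▷ A ≫ app φ = _
    rw [act_I, powB_zero, hc]
    simp
  | succ n ih =>
    refine app_cancel φ ?_
    have h := rep_C (φ := φ) true
    unfold Rep evTensor at h
    rw [if_pos rfl] at h
    rw [sigma_succ, act_comp]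
    calc _ = 𝟙 _ ⊗≫ act φ ((reflexiveAlgebra φ).ap (reflexiveAlgebra φ).B
            ((reflexiveAlgebra φ).sigma 1 n)) ▷ (A ⊗ A) ≫
          (act φ ((reflexiveAlgebra φ).C true) ▷ (A ⊗ A) ≫ (α_ A A A).inv ≫ app φ ▷ A ≫
            app φ) := by monoidal
      _ = 𝟙 _ ⊗≫ (act φ ((reflexiveAlgebra φ).ap (reflexiveAlgebra φ).B
            ((reflexiveAlgebra φ).sigma 1 n)) ▷ (A ⊗ A) ≫ A ◁ (β_ A A).hom) ⊗≫
          app φ ▷ A ≫ app φ := by rw [h]; monoidal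
      _ = 𝟙 _ ⊗≫ A ◁ (β_ A A).hom ⊗≫ (act φ ((reflexiveAlgebra φ).ap (reflexiveAlgebra φ).B
            ((reflexiveAlgebra φ).sigma 1 n)) ▷ A ≫ app φ) ▷ A ≫ app φ := by
          rw [← whisker_exchange]; monoidal
      _ = 𝟙 _ ⊗≫ A ◁ (β_ A A).hom ⊗≫ app φ ▷ A ≫
          (act φ ((reflexiveAlgebra φ).sigma 1 n) ▷ A ≫ app φ) := by
          rw [act_ap_B]; monoidal
      _ = ((α_ A A A).hom ≫ A ◁ (β_ A A).hom ≫ (α_ A A A).inv ≫ app φ ▷ A ≫ (β_ A A).inv) ≫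
          c ▷ A ≫ powB φ n := by
          rw [ih]; monoidal
      _ = ((β_ A A).inv ▷ A ≫ (α_ A A A).hom ≫ A ◁ app φ) ≫ c ▷ A ≫ powB φ n := by
          congr 1
          simp
      _ = (β_ A A).inv ▷ A ≫ (α_ A A A).hom ≫ c ▷ (A ⊗ A) ≫ A ◁ app φ ≫ powB φ n := by
          rw [Category.assoc, Category.assoc, whisker_exchange_assoc]
      _ = (β_ A A).inv ▷ A ≫ c ▷ A ▷ A ≫ ((α_ A A A).hom ≫ A ◁ app φ ≫ powB φ n) := by
          monoidal
      _ = _ := by rw [← powB_succ_app]; monoidal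

/-- Naturality of the braid of the internal PRO. -/
theorem sigma_comp {m n : ℕ} {a : 𝟙_ C ⟶ A} (ha : (reflexiveAlgebra φ).Arity m n a) :
    (reflexiveAlgebra φ).comp ((reflexiveAlgebra φ).sigma 1 m) a =
      (reflexiveAlgebra φ).comp ((reflexiveAlgebra φ).ap (reflexiveAlgebra φ).B a)
        ((reflexiveAlgebra φ).sigma 1 n) := by
  -- By the closed form the claim is Bᵐ (c (x)) (a k) = a (Bⁿ (c (x)) k), an instance of the arity
  -- equation after the crossing.
  obtain ⟨c, hc⟩ := exists_curry φ ((β_ A A).hom ≫ app φ)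
  rw [arity_iff] at ha
  refine act_injective φ (app_cancel φ ?_)
  rw [act_comp, act_comp, comp_whiskerRight_assoc, comp_whiskerRight_assoc, act_sigma φ hc,
    act_ap_B, reassoc_of% (act_sigma φ hc n), ← ha,
    BraidedCategory.braiding_inv_naturality_left_assoc, whisker_exchange_assoc]

theorem ap_B_alphaComb_comp_C :
    (reflexiveAlgebra φ).comp ((reflexiveAlgebra φ).ap (reflexiveAlgebra φ).B (alphaComb φ))
      ((reflexiveAlgebra φ).C false) =
    (reflexiveAlgebra φ).comp (alphaComb φ)
      ((reflexiveAlgebra φ).ap (reflexiveAlgebra φ).B ((reflexiveAlgebra φ).C true)) := by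
  have c1 := cancels_app φ
  refine (rep_alphaComb.lift.left_unit'.comp
    ((rep_C (φ := φ) false).whiskerRight (app φ)).assoc_left.assoc_right).eq
    ((rep_alphaComb.whiskerRight (app φ)).unit_left.assoc_right.comp (rep_C true).lift) c1 ?_
  have h := whiskerRight_braiding_inv_coev A (dualUnit φ)
  simp only [Bool.false_eq_true, if_false, if_true]
  calc _ = 𝟙 _ ⊗≫ (A ◁ dualUnit φ ⊗≫ (β_ A A).inv ▷ A) ⊗≫ 𝟙 _ := by monoidal
    _ = _ := by rw [h]; monoidal

theorem C_comp_ap_B {c : 𝟙_ C ⟶ A} {γ : A ⊗ A ⟶ 𝟙_ C}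
    (hc : Rep φ (evTensor (app φ) (app φ)) (ρ_ A).hom γ c) :
    (reflexiveAlgebra φ).comp ((reflexiveAlgebra φ).C true)
      ((reflexiveAlgebra φ).ap (reflexiveAlgebra φ).B c) =
    (reflexiveAlgebra φ).comp
      ((reflexiveAlgebra φ).ap (reflexiveAlgebra φ).B ((reflexiveAlgebra φ).C false)) c := by
  have c1 := cancels_app φ
  refine (((rep_C (φ := φ) true).whiskerRight (app φ)).assoc_left.assoc_right.comp
    hc.lift.right_unit').eq ((rep_C false).lift.comp
      (hc.whiskerRight (app φ)).assoc_left.right_unit) (c1.tensor (c1.tensor c1)) ?_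
  have h := whiskerLeft_braiding_inv_ev A γ
  simp only [Bool.false_eq_true, if_false, if_true]
  symm
  calc _ = 𝟙 _ ⊗≫ (A ◁ (β_ A A).inv ⊗≫ γ ▷ A) ⊗≫ 𝟙 _ := by monoidal
    _ = _ := by rw [h]; monoidal

/-- The m strands slide across α one at a time, so crossings with one leg become crossings with the
other; interchange brings each new crossing next to α. -/
theorem shift_alphaComb_comp_sigmaInv (m : ℕ) :
    (reflexiveAlgebra φ).comp ((reflexiveAlgebra φ).shift m (alphaComb φ))
      ((reflexiveAlgebra φ).sigmaInv 1 m) =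
    (reflexiveAlgebra φ).comp (alphaComb φ)
      ((reflexiveAlgebra φ).ap (reflexiveAlgebra φ).B ((reflexiveAlgebra φ).sigma 1 m)) := by
  induction m with
  | zero =>
    change (reflexiveAlgebra φ).comp (alphaComb φ) (reflexiveAlgebra φ).I =
      (reflexiveAlgebra φ).comp (alphaComb φ)
        ((reflexiveAlgebra φ).ap (reflexiveAlgebra φ).B (reflexiveAlgebra φ).I)
    rw [ap_B_I]
  | succ m ih =>
    have h := comp_shift (arity_C φ false) ((reflexiveAlgebra φ).sigma 1 m)
    change (reflexiveAlgebra φ).comp ((reflexiveAlgebra φ).ap (reflexiveAlgebra φ).B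
      ((reflexiveAlgebra φ).shift m (alphaComb φ))) _ = _
    rw [sigmaInv_succ, sigma_succ, ← comp_assoc, ← ap_B_comp, ih, ap_B_comp, ap_B_comp,
      comp_assoc]
    refine (congrArg _ h.symm).trans ?_
    rw [← comp_assoc, ap_B_alphaComb_comp_C, comp_assoc]
    rfl

theorem sigma_comp_shift {c : 𝟙_ C ⟶ A} {γ : A ⊗ A ⟶ 𝟙_ C}
    (hc : Rep φ (evTensor (app φ) (app φ)) (ρ_ A).hom γ c) (n : ℕ) :
    (reflexiveAlgebra φ).comp ((reflexiveAlgebra φ).sigma 1 n)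
      ((reflexiveAlgebra φ).shift n c) =
    (reflexiveAlgebra φ).comp
      ((reflexiveAlgebra φ).ap (reflexiveAlgebra φ).B ((reflexiveAlgebra φ).sigmaInv 1 n)) c := by
  induction n with
  | zero =>
    change (reflexiveAlgebra φ).comp (reflexiveAlgebra φ).I c = (reflexiveAlgebra φ).comp
      ((reflexiveAlgebra φ).ap (reflexiveAlgebra φ).B (reflexiveAlgebra φ).I) c
    rw [ap_B_I]
  | succ n ih =>
    have h := comp_shift (arity_C φ true) ((reflexiveAlgebra φ).sigmaInv 1 n)
    change (reflexiveAlgebra φ).comp _ ((reflexiveAlgebra φ).ap (reflexiveAlgebra φ).B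
      ((reflexiveAlgebra φ).shift n c)) = _
    rw [sigmaInv_succ, sigma_succ, comp_assoc, ← ap_B_comp, ih, ap_B_comp, ap_B_comp,
      ← comp_assoc]
    refine (congrArg (fun x => (reflexiveAlgebra φ).comp x _) h).trans ?_
    rw [comp_assoc, C_comp_ap_B φ hc, ← comp_assoc]
    rfl

/-- As β is its own twist, the closing map of the right trace represents β again; a further crossing
equals an inverse twist before β. -/
theorem C_comp_C_comp_betaComb :
    (reflexiveAlgebra φ).comp ((reflexiveAlgebra φ).C true)
      ((reflexiveAlgebra φ).comp ((reflexiveAlgebra φ).C true)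
        ((reflexiveAlgebra φ).comp ((reflexiveAlgebra φ).ap (reflexiveAlgebra φ).B
          ((reflexiveAlgebra φ).θ true)) (betaComb φ))) =
    (reflexiveAlgebra φ).comp ((reflexiveAlgebra φ).θ false) (betaComb φ) := by
  have c1 := cancels_app φ
  refine ((rep_C true).comp ((rep_C true).comp ((rep_theta true).lift.comp rep_betaComb))).eq
    (((rep_theta false).whiskerRight (app φ)).comp rep_betaComb) (c1.tensor c1) ?_
  have h := twistEv_dualCounit φ
  have h2 := h
  rw [twistEv_eq] at h2
  unfold twistEv at h
  simp only [Bool.false_eq_true, if_false, if_true]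
  rw [h]
  conv_rhs => rw [← h2]
  simp

theorem alphaComb_comp_C_comp_theta :
    (reflexiveAlgebra φ).comp (alphaComb φ)
      ((reflexiveAlgebra φ).comp ((reflexiveAlgebra φ).C false) ((reflexiveAlgebra φ).θ false)) =
    alphaComb φ := by
  refine (rep_alphaComb.comp ((rep_C false).comp ((rep_theta false).whiskerRight (app φ)))).eq
    rep_alphaComb cancels_unit ?_
  conv_rhs => rw [← twistCoev_dualUnit]
  simp [twistCoev]

/-- Sliding through α and the closing map turns σ_{1,m}⁻¹ and σ_{1,n} into B σ_{1,m} and B σ_{1,n}⁻¹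
around a. By naturality of the braid these cancel up to C⁻ ∘ (B a) ∘ C⁺. The leftover crossings give
θ⁻ in front of β, which commutes with B a by interchange and is absorbed with C⁻ by α. -/
theorem leftTrace_eq {m n : ℕ} {a : 𝟙_ C ⟶ A}
    (ha : (reflexiveAlgebra φ).Arity (m + 1) (n + 1) a) :
    (reflexiveAlgebra φ).leftTrace (alphaComb φ) (betaComb φ) m n a =
      (reflexiveAlgebra φ).comp (alphaComb φ) ((reflexiveAlgebra φ).comp
        ((reflexiveAlgebra φ).ap (reflexiveAlgebra φ).B a) (betaComb φ)) := by
  set c := (reflexiveAlgebra φ).comp ((reflexiveAlgebra φ).C true)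
    ((reflexiveAlgebra φ).comp ((reflexiveAlgebra φ).ap (reflexiveAlgebra φ).B
      ((reflexiveAlgebra φ).θ true)) (betaComb φ)) with hc
  have rc := (rep_C (φ := φ) true).comp ((rep_theta true).lift.comp rep_betaComb)
  rw [← hc] at rc
  have e1 := sigma_comp φ ha
  rw [sigma_succ, sigma_succ] at e1
  have e2 : (reflexiveAlgebra φ).comp
      ((reflexiveAlgebra φ).ap (reflexiveAlgebra φ).B ((reflexiveAlgebra φ).sigma 1 m)) a =
      (reflexiveAlgebra φ).comp ((reflexiveAlgebra φ).C false) ((reflexiveAlgebra φ).comp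
        ((reflexiveAlgebra φ).ap (reflexiveAlgebra φ).B a)
        ((reflexiveAlgebra φ).comp ((reflexiveAlgebra φ).C true)
        ((reflexiveAlgebra φ).ap (reflexiveAlgebra φ).B ((reflexiveAlgebra φ).sigma 1 n)))) := by
    rw [← e1, comp_assoc, ← comp_assoc ((reflexiveAlgebra φ).C false)]
    have := C_comp_C φ false
    rw [Bool.not_false] at this
    rw [this, I_comp]
  have e3 : (reflexiveAlgebra φ).comp ((reflexiveAlgebra φ).ap (reflexiveAlgebra φ).B a)
      ((reflexiveAlgebra φ).θ false) = (reflexiveAlgebra φ).comp ((reflexiveAlgebra φ).θ false)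
      ((reflexiveAlgebra φ).ap (reflexiveAlgebra φ).B a) :=
    (comp_shift (arity_theta φ false) a).symm
  unfold BalancedData.leftTrace BalancedData.rightTrace
  rw [← hc, comp_assoc, comp_assoc, sigma_comp_shift φ rc, ← comp_assoc,
    shift_alphaComb_comp_sigmaInv, comp_assoc, ← comp_assoc _ a, e2]
  simp only [comp_assoc]
  rw [← comp_assoc ((reflexiveAlgebra φ).ap _ ((reflexiveAlgebra φ).sigma 1 n)), ← ap_B_comp,
    sigma_comp_sigmaInv, ap_B_I, I_comp, hc, C_comp_C_comp_betaComb, ← comp_assoc _ _ (betaComb φ),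
    e3, comp_assoc, ← comp_assoc ((reflexiveAlgebra φ).C false), ← comp_assoc,
    alphaComb_comp_C_comp_theta]

end Duality

end RibbonCA

theorem mainTheorem3 {C : Type u} [Category.{v} C] [MonoidalCategory C] [BraidedCategory C]
    [BalancedCategory C] [RightRigidCategory C] [RibbonCategory C]
    (A : C) (φ : A ⊗ (Aᘁ : C) ≅ A) :
    -- `C(I, A)` with the combinators given by `F` is a balanced extensional `BC±I`-algebra
    (reflexiveAlgebra φ).IsBalanced ∧
    (∀ (t : Bool) (a : 𝟙_ C ⟶ A), FElem φ a =
      (reflexiveAlgebra φ).ap ((reflexiveAlgebra φ).ap ((reflexiveAlgebra φ).C t)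
        (reflexiveAlgebra φ).I) a) ∧
    -- `F` is a strict monoidal functor to the internal PRO
    (∀ (m n : ℕ) (f : tpow A m ⟶ tpow A n), (reflexiveAlgebra φ).Arity m n (F φ f)) ∧
    (∀ m : ℕ, F φ (𝟙 (tpow A m)) = (reflexiveAlgebra φ).I) ∧
    (∀ (l m n : ℕ) (f : tpow A l ⟶ tpow A m) (g : tpow A m ⟶ tpow A n),
      F φ (f ≫ g) = (reflexiveAlgebra φ).comp (F φ f) (F φ g)) ∧
    (∀ (m n m' n' : ℕ) (f : tpow A m ⟶ tpow A n) (g : tpow A m' ⟶ tpow A n'),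
      F φ ((tpowAdd A m' m).inv ≫ (f ⊗ₘ g) ≫ (tpowAdd A n' n).hom) =
        (reflexiveAlgebra φ).tensor n (F φ f) (F φ g)) ∧
    -- application of `Tr = F(lam)` is the left trace of the internal PRO, for its self-duality
    -- `F(α)`, `F(β)` of the object `1`
    (∀ (m n : ℕ) (a : 𝟙_ C ⟶ A), (reflexiveAlgebra φ).Arity (1 + m) (1 + n) a →
      (reflexiveAlgebra φ).Arity m n ((reflexiveAlgebra φ).ap (traceComb φ) a) ∧
      (reflexiveAlgebra φ).ap (traceComb φ) a =
        (reflexiveAlgebra φ).leftTrace (alphaComb φ) (betaComb φ) m n a ∧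
      (reflexiveAlgebra φ).ap (traceComb φ) a =
        (reflexiveAlgebra φ).comp (alphaComb φ) ((reflexiveAlgebra φ).comp
          ((reflexiveAlgebra φ).ap (reflexiveAlgebra φ).B a) (betaComb φ))) ∧
    -- `C(I, A)` is a ribbon combinatory algebra, in both equivalent forms
    (reflexiveAlgebra φ).IsTraced (traceComb φ) ∧
    (reflexiveAlgebra φ).IsRibbon (alphaComb φ) (betaComb φ) := by
  refine ⟨isBalanced, fun t a => (rep_FElem a).eq (rep_CI t a) cancels_unit rfl,
    fun m n f => arity_F f, F_id, fun l m n f g => F_comp f g,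
    fun m n m' n' f g => F_tensor f g, ?_, isTraced φ, isRibbon φ⟩
  intro m n a ha
  -- The powers of B are defined by recursion on successors.
  rw [Nat.add_comm 1 m, Nat.add_comm 1 n] at ha
  exact ⟨arity_ap_traceComb φ ha, (ap_traceComb_eq φ a).trans (leftTrace_eq φ ha).symm,
    ap_traceComb_eq φ a⟩
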